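/- Let $(M,g)$ be a connected semi-Riemannian manifold and let $\varepsilon\in\{1,-1\}$. Equip $M\times\mathbb{R}$ with the metric $g+\varepsilon\,dt^2$. Let $\Sigma$ be a Lie group acting smoothly on $M$ by isometries, let $I\subseteq\mathbb{R}$ be an open interval, and let $\pi:M\to I$ be a smooth surjective submersion whose fibers are the orbits of the action. Assume that the gradient $\nabla\pi$ is nowhere lightlike, and write $|\nabla\pi|^2=g(\nabla\pi,\nabla\pi)$. Let $h:I\to\mathbb{R}$ represent the mean curvature of the fibers: for each $s\in I$, $h(s)$ is the mean curvature of $\pi^{-1}(s)$ with respect to its unit normal $N=\nabla\pi/\sqrt{\big||\nabla\pi|^2\big|}$, i.e. $h(s)=\sum_i\varepsilon_i\,g(\nabla_{e_i}N,e_i)$ for every orthonormal basis $(e_i)$ of a tangent space of $\pi^{-1}(s)$, where $\varepsilon_i=g(e_i,e_i)=\pm1$. A $C^2$ map $F$ into $M\times\mathbb{R}$ is called a translating soliton if the metric it induces is nondegenerate everywhere and its mean curvature vector (the trace of the second fundamental form) satisfies $\vec H=\partial_t^{\perp}$, the normal component of $\partial_t$. Then there is $\widetilde\varepsilon\in\{1,-1\}$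 with $\widetilde\varepsilon\,|\nabla\pi|^2>0$ on all of $M$, and there is a function $v:I\to\mathbb{R}$ with $$v'(\pi(x))=\frac{1}{\sqrt{\widetilde\varepsilon\,|\nabla\pi|^2(x)}}\qquad\text{for all }x\in M .$$ For every such $v$ the following holds. Let $u\in C^2(M,\mathbb{R})$ be such that $\varepsilon+|\nabla u|^2$ does not vanish identically on $M$ (that is, the graph of $u$ is not everywhere degenerate), and let $F:M\to M\times\mathbb{R}$, $F(x)=(x,u(x))$, be its graph map. Then $F$ is a $\Sigma$-invariant translating soliton (that is, $F$ is a translating soliton and $u(\sigma\cdot x)=u(x)$ for all $\sigma\in\Sigma$, $x\in M$) if and only if there is a function $f\in C^2(v(I),\mathbb{R})$ with $u=f\circ v\circ\pi$ and $$f''(v(s))=\big(\widetilde\varepsilon+\varepsilon f'(v(s))^2\big)\big(1-f'(v(s))\,h(s)\big)\qquad\text{for all }s\in I .$$ -/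

import Mathlib

open scoped Manifold ContDiff

noncomputable section

namespace SemiRiem

/-! ## Linear algebra of scalar products -/

section LinearAlgebra

variable {V W : Type*} [AddCommGroup V] [Module ℝ V] [FiniteDimensional ℝ V]
  [AddCommGroup W] [Module ℝ W]

open Classical in
/-- The vector `ℓ^♯` dual to the functional `ℓ`: for nondegenerate `B` it is the unique vector with
`B (ℓ^♯) w = ℓ w` for all `w` (and it is `0` for a degenerate `B`). -/
def sharp (B : LinearMap.BilinForm ℝ V) (ℓ : V →ₗ[ℝ] ℝ) : V :=
  if hB : B.Nondegenerate then (B.toDual hB).symm ℓ else 0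

theorem apply_sharp {B : LinearMap.BilinForm ℝ V} (hB : B.Nondegenerate) (ℓ : V →ₗ[ℝ] ℝ) (w : V) :
    B (sharp B ℓ) w = ℓ w := by
  rw [sharp, dif_pos hB]
  exact LinearMap.BilinForm.apply_toDual_symm_apply ℓ w

/-- The trace of a bilinear map `S` with respect to the scalar product `B`, i.e.
`∑ᵢⱼ Bⁱʲ S(eᵢ, eⱼ)` in a basis `(eᵢ)`, where `(Bⁱʲ)` is the inverse of the matrix
`(B(eᵢ, eⱼ))`. In a `B`-orthonormal basis it is `∑ᵢ B(eᵢ, eᵢ) S(eᵢ, eᵢ)`. -/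
def metricTrace (B : LinearMap.BilinForm ℝ V) (S : V → V → W) : W :=
  ∑ i, S (sharp B ((Module.finBasis ℝ V).coord i)) (Module.finBasis ℝ V i)

end LinearAlgebra

/-! ## Semi-Riemannian metrics, in the preferred charts of a manifold without boundary -/

section Metric

variable {E : Type*} [NormedAddCommGroup E] [NormedSpace ℝ E] [FiniteDimensional ℝ E]
  {H : Type*} [TopologicalSpace H] (I : ModelWithCorners ℝ E H)
  (M : Type*) [TopologicalSpace M] [ChartedSpace H M]

instance finiteDimensional_tangentSpace (x : M) : FiniteDimensional ℝ (TangentSpace I x) :=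
  inferInstanceAs (FiniteDimensional ℝ E)

/-- A field of bilinear forms on the tangent spaces of `M`. -/
abbrev TensorField2 : Type _ :=
  ∀ x : M, TangentSpace I x →L[ℝ] TangentSpace I x →L[ℝ] ℝ

variable {I M}

/-- The bilinear form on the tangent space at `x` given by a tensor field. -/
def formAt (g : TensorField2 I M) (x : M) : LinearMap.BilinForm ℝ (TangentSpace I x) :=
  (g x).toBilinForm

/-- `g` is a smooth semi-Riemannian metric: symmetric, nondegenerate and smooth. (On a connected
manifold the index is then automatically constant.) -/
structure IsSemiRiemannianMetric [IsManifold I ∞ M] (g : TensorField2 I M) : Prop where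
  symm : ∀ (x : M) (a b : TangentSpace I x), g x a b = g x b a
  nondegenerate : ∀ x : M, (formAt g x).Nondegenerate
  smooth : ContMDiff I (I.prod 𝓘(ℝ, E →L[ℝ] E →L[ℝ] ℝ)) ∞
    (fun x ↦ Bundle.TotalSpace.mk' (E →L[ℝ] E →L[ℝ] ℝ)
      (E := fun x : M ↦ TangentSpace I x →L[ℝ] TangentSpace I x →L[ℝ] ℝ) x (g x))

/-- The gradient `∇w` of a function `w`: `g (∇w) a = dw a`. -/
def gradient (g : TensorField2 I M) (w : M → ℝ) (x : M) : TangentSpace I x :=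
  sharp (formAt g x) (mfderiv I 𝓘(ℝ, ℝ) w x).toLinearMap

/-- The squared length `|∇w|² = g(∇w, ∇w)`, a function of any sign. -/
def gradNormSq (g : TensorField2 I M) (w : M → ℝ) (x : M) : ℝ :=
  g x (gradient g w x) (gradient g w x)

/-- A tangent vector is lightlike if it is a nonzero null vector. -/
def IsLightlike (g : TensorField2 I M) (x : M) (a : TangentSpace I x) : Prop :=
  a ≠ 0 ∧ g x a a = 0

/-- The metric in the preferred chart around `p`: `y ↦ (gᵢⱼ(y))`, the pullback of `g` by the inverse
of the chart. The tangent space at `p` itself is identified with `E` by this same chart. -/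
def metricInChart (g : TensorField2 I M) (p : M) (y : E) : E →L[ℝ] E →L[ℝ] ℝ :=
  ContinuousLinearMap.bilinearComp (E := E) (F := E) (E' := E) (F' := E)
    (g ((extChartAt I p).symm y))
    (mfderiv 𝓘(ℝ, E) I (extChartAt I p).symm y)
    (mfderiv 𝓘(ℝ, E) I (extChartAt I p).symm y)

/-- The Christoffel symbols `Γ(a, b)` of `g` at `p` in the preferred chart around `p`:
`2 g(Γ(a, b), c) = ∂ₐ g(b, c) + ∂_b g(a, c) - ∂_c g(a, b)`. -/
def christoffel (g : TensorField2 I M) (p : M) (a b : TangentSpace I p) : TangentSpace I p :=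
  let D : E →L[ℝ] E →L[ℝ] E →L[ℝ] ℝ := fderiv ℝ (metricInChart g p) (extChartAt I p p)
  let a' : E := a
  let b' : E := b
  let ℓ : E →L[ℝ] ℝ := (1 / 2 : ℝ) • (D a' b' + D b' a' - (D.flip a').flip b')
  sharp (formAt g p) ℓ.toLinearMap

/-- The Levi-Civita covariant derivative `∇ₐ Y` at `p` of the vector field `Y`, computed in the
preferred chart around `p`: `∂ₐ Y + Γ(a, Y)`. -/
def covDeriv (g : TensorField2 I M) (Y : ∀ x : M, TangentSpace I x) (p : M)
    (a : TangentSpace I p) : TangentSpace I p :=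
  let Yhat : E → E := fun y ↦
    mfderiv I 𝓘(ℝ, E) (extChartAt I p) ((extChartAt I p).symm y) (Y ((extChartAt I p).symm y))
  let a' : E := a
  let dY : TangentSpace I p := fderiv ℝ Yhat (extChartAt I p p) a'
  dY + christoffel g p a (Y p)

/-! ### Mean curvature of the level sets of a function -/

/-- The unit normal `∇w / √| |∇w|² |` of the level sets of `w`. -/
def unitNormal (g : TensorField2 I M) (w : M → ℝ) (x : M) : TangentSpace I x :=
  (√|gradNormSq g w x|)⁻¹ • gradient g w x

/-- The mean curvature at `x` of the level set of `w` through `x`, with respect to the unit normal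
`N = ∇w / √| |∇w|² |`: the trace `∑ᵢ εᵢ g(∇_{eᵢ} N, eᵢ)` of the form `(a, b) ↦ g(∇ₐ N, b)` over the
tangent space `ker dw` of the level set. -/
def levelMeanCurvature (g : TensorField2 I M) (w : M → ℝ) (x : M) : ℝ :=
  let T : Submodule ℝ (TangentSpace I x) := LinearMap.ker (mfderiv I 𝓘(ℝ, ℝ) w x).toLinearMap
  metricTrace ((formAt g x).restrict T) fun a b : T ↦ g x (covDeriv g (unitNormal g w) x a) b

end Metric

/-! ## Mean curvature of a map into a semi-Riemannian manifold -/

section Immersion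

variable {E : Type*} [NormedAddCommGroup E] [NormedSpace ℝ E] [FiniteDimensional ℝ E]
  {H : Type*} [TopologicalSpace H] {I : ModelWithCorners ℝ E H}
  {N : Type*} [TopologicalSpace N] [ChartedSpace H N]
  {E' : Type*} [NormedAddCommGroup E'] [NormedSpace ℝ E'] [FiniteDimensional ℝ E']
  {H' : Type*} [TopologicalSpace H'] {J : ModelWithCorners ℝ E' H'}
  {P : Type*} [TopologicalSpace P] [ChartedSpace H' P]

variable (I) in
/-- The induced form `F^* g` on the tangent space at `x`. -/
def inducedForm (g : TensorField2 J P) (F : N → P) (x : N) :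
    LinearMap.BilinForm ℝ (TangentSpace I x) :=
  (formAt g (F x)).comp (mfderiv I J F x).toLinearMap (mfderiv I J F x).toLinearMap

variable (I) in
/-- The component of `Z`, a vector at `F x`, normal to the image of `dF`: one subtracts `dF X`, where
`X` is the vector with `g(dF X, dF Y) = g(Z, dF Y)` for all `Y`. Meaningful where the induced form
is nondegenerate. -/
def normalPart (g : TensorField2 J P) (F : N → P) (x : N) (Z : TangentSpace J (F x)) :
    TangentSpace J (F x) :=
  Z - mfderiv I J F x
    (sharp (inducedForm I g F x) ((formAt g (F x) Z).comp (mfderiv I J F x).toLinearMap))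

variable (I) in
/-- The second fundamental form `II(a, b)` of `F` at `x`: the normal part of the ambient covariant
derivative of `dF b` (with `b` constant in the chart) in the direction `a`, which in charts is
`D²F(a, b) + Γ(dF a, dF b)`. Another chart around `x` changes this vector by a tangential one. -/
def secondFundForm (g : TensorField2 J P) (F : N → P) (x : N) (a b : TangentSpace I x) :
    TangentSpace J (F x) :=
  let a' : E := a
  let b' : E := b
  let D2 : TangentSpace J (F x) := fderiv ℝ (fderiv ℝ (writtenInExtChartAt I J x F)) (extChartAt I x x) a' b'
  normalPart I g F x (D2 + christoffel g (F x) (mfderiv I J F x a) (mfderiv I J F x b))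

variable (I) in
/-- The mean curvature vector of `F` at `x`, the (unnormalized) trace of the second fundamental form
with respect to the induced metric. -/
def meanCurvatureVector (g : TensorField2 J P) (F : N → P) (x : N) : TangentSpace J (F x) :=
  metricTrace (inducedForm I g F x) (secondFundForm I g F x)

end Immersion

/-! ## Translating solitons in `M × ℝ` -/

section Soliton

variable {E : Type*} [NormedAddCommGroup E] [NormedSpace ℝ E] [FiniteDimensional ℝ E]
  {H : Type*} [TopologicalSpace H] {I : ModelWithCorners ℝ E H}
  {M : Type*} [TopologicalSpace M] [ChartedSpace H M]

/-- The product metric `g + ε dt²` on `M × ℝ`: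
`(a, α), (b, β) ↦ g(a, b) + ε α β`. -/
def productMetric (g : TensorField2 I M) (ε : ℝ) : TensorField2 (I.prod 𝓘(ℝ, ℝ)) (M × ℝ) :=
  fun p ↦
    let g₁ : E →L[ℝ] E →L[ℝ] ℝ := g p.1
    let G : E × ℝ →L[ℝ] E × ℝ →L[ℝ] ℝ :=
      g₁.bilinearComp (ContinuousLinearMap.fst ℝ E ℝ) (ContinuousLinearMap.fst ℝ E ℝ) +
        ε • (ContinuousLinearMap.mul ℝ ℝ).bilinearComp
          (ContinuousLinearMap.snd ℝ E ℝ) (ContinuousLinearMap.snd ℝ E ℝ)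
    G

variable (I) in
/-- The vertical unit vector field `∂ₜ` on `M × ℝ`. -/
def verticalField (p : M × ℝ) : TangentSpace (I.prod 𝓘(ℝ, ℝ)) p :=
  ((0, 1) : E × ℝ)

/-- `F : N → M × ℝ` is a (vertical) translating soliton in `(M × ℝ, g + ε dt²)`: it is of class `C²`,
the induced form is nondegenerate everywhere (in particular `F` is an immersion), and the mean
curvature vector is the normal component of `∂ₜ`. -/
def IsTranslatingSoliton {E' : Type*} [NormedAddCommGroup E'] [NormedSpace ℝ E']
    [FiniteDimensional ℝ E'] {H' : Type*} [TopologicalSpace H'] (I' : ModelWithCorners ℝ E' H')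
    {N : Type*} [TopologicalSpace N] [ChartedSpace H' N]
    (g : TensorField2 I M) (ε : ℝ) (F : N → M × ℝ) : Prop :=
  ContMDiff I' (I.prod 𝓘(ℝ, ℝ)) 2 F ∧
  (∀ x, (inducedForm I' (productMetric g ε) F x).Nondegenerate) ∧
  ∀ x, meanCurvatureVector I' (productMetric g ε) F x =
    normalPart I' (productMetric g ε) F x (verticalField I (F x))

/-- The graph map of a function. -/
def graphMap (u : M → ℝ) (x : M) : M × ℝ := (x, u x)

/-- The group `S` acts on `M` by isometries of `g`. -/
def ActsByIsometries (S : Type*) [SMul S M] (g : TensorField2 I M) : Prop :=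
  ∀ (σ : S) (x : M) (a b : TangentSpace I x),
    g (σ • x) (mfderiv I I (fun y : M ↦ σ • y) x a) (mfderiv I I (fun y : M ↦ σ • y) x b) = g x a b

/-- The function `u` is invariant under the action of `S`. -/
def IsInvariantUnder (S : Type*) [SMul S M] (u : M → ℝ) : Prop :=
  ∀ (σ : S) (x : M), u (σ • x) = u x

end Soliton

end SemiRiem

end

open scoped Manifold ContDiff

set_option maxSynthPendingDepth 3
set_option linter.unusedSectionVars false

noncomputable section

namespace SemiRiem

open Filter Topology

section LinearAlgebra

variable {V V' : Type*} [AddCommGroup V] [Module ℝ V] [AddCommGroup V'] [Module ℝ V']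

theorem nondegenerate_of_symm {B : LinearMap.BilinForm ℝ V} (hs : ∀ a b, B a b = B b a)
    (h : ∀ a, (∀ b, B a b = 0) → a = 0) : B.Nondegenerate :=
  ⟨fun a ha ↦ h a ha, fun a ha ↦ h a fun b ↦ (hs a b).trans (ha b)⟩

theorem eq_of_forall_apply {B : LinearMap.BilinForm ℝ V} (hB : B.Nondegenerate) {a b : V}
    (h : ∀ c, B a c = B b c) : a = b :=
  sub_eq_zero.1 (hB.1 _ fun c ↦ by simp [h c])

theorem nondegenerate_comp_equiv {B : LinearMap.BilinForm ℝ V} (hB : B.Nondegenerate)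
    (hs : ∀ a b, B a b = B b a) (A : V' ≃ₗ[ℝ] V) {B' : LinearMap.BilinForm ℝ V'}
    (hB' : ∀ a b, B' a b = B (A a) (A b)) : B'.Nondegenerate := by
  refine nondegenerate_of_symm (fun a b ↦ by rw [hB', hB', hs]) fun a ha ↦ ?_
  have : A a = 0 := hB.1 _ fun c ↦ by simpa [hB'] using ha (A.symm c)
  simpa using this

variable [FiniteDimensional ℝ V] [FiniteDimensional ℝ V']

theorem sharp_eq {B : LinearMap.BilinForm ℝ V} (hB : B.Nondegenerate) {ℓ : V →ₗ[ℝ] ℝ} {z : V}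
    (h : ∀ w, B z w = ℓ w) : sharp B ℓ = z :=
  eq_of_forall_apply hB fun c ↦ by rw [apply_sharp hB, h]

/-- The musical isomorphism as a linear map. -/
def sharpₗ (B : LinearMap.BilinForm ℝ V) : (V →ₗ[ℝ] ℝ) →ₗ[ℝ] V where
  toFun := sharp B
  map_add' k l := by unfold sharp; split_ifs <;> simp
  map_smul' c l := by unfold sharp; split_ifs <;> simp

theorem sharpₗ_apply (B : LinearMap.BilinForm ℝ V) (ℓ : V →ₗ[ℝ] ℝ) :
    sharpₗ B ℓ = sharp B ℓ := rfl

/-- The endomorphism `L` with `B (L b) a = S a b`. -/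
def raise (B S : LinearMap.BilinForm ℝ V) : V →ₗ[ℝ] V :=
  sharpₗ B ∘ₗ S.flip

theorem apply_raise {B : LinearMap.BilinForm ℝ V} (hB : B.Nondegenerate)
    (S : LinearMap.BilinForm ℝ V) (a b : V) : B (raise B S b) a = S a b := by
  simp [raise, sharpₗ_apply, apply_sharp hB]

theorem raise_eq {B : LinearMap.BilinForm ℝ V} (hB : B.Nondegenerate)
    {S : LinearMap.BilinForm ℝ V} {L : V →ₗ[ℝ] V} (h : ∀ a b, B (L b) a = S a b) :
    raise B S = L :=
  LinearMap.ext fun b ↦ eq_of_forall_apply hB fun a ↦ by rw [apply_raise hB, h]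

theorem metricTrace_eq_trace {B : LinearMap.BilinForm ℝ V} (hB : B.Nondegenerate)
    (hs : ∀ a b, B a b = B b a) (S : LinearMap.BilinForm ℝ V) :
    metricTrace B (fun a b ↦ S a b) = LinearMap.trace ℝ V (raise B S) := by
  rw [LinearMap.trace_eq_matrix_trace ℝ (Module.finBasis ℝ V), Matrix.trace, metricTrace]
  refine Finset.sum_congr rfl fun i _ ↦ ?_
  rw [Matrix.diag_apply, LinearMap.toMatrix_apply, ← apply_raise hB, hs, apply_sharp hB]
  rfl

theorem sharp_comp_equiv {B : LinearMap.BilinForm ℝ V} (hB : B.Nondegenerate)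
    (hs : ∀ a b, B a b = B b a) (A : V' ≃ₗ[ℝ] V) {B' : LinearMap.BilinForm ℝ V'}
    (hB' : ∀ a b, B' a b = B (A a) (A b)) {ℓ : V →ₗ[ℝ] ℝ} {ℓ' : V' →ₗ[ℝ] ℝ}
    (hℓ : ∀ a, ℓ' a = ℓ (A a)) : A (sharp B' ℓ') = sharp B ℓ := by
  refine (sharp_eq hB fun w ↦ ?_).symm
  have := apply_sharp (nondegenerate_comp_equiv hB hs A hB') ℓ' (A.symm w)
  simpa [hB', hℓ] using this

theorem metricTrace_comp_equiv {B : LinearMap.BilinForm ℝ V} (hB : B.Nondegenerate)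
    (hs : ∀ a b, B a b = B b a) (A : V' ≃ₗ[ℝ] V) {B' : LinearMap.BilinForm ℝ V'}
    (hB' : ∀ a b, B' a b = B (A a) (A b)) {S : LinearMap.BilinForm ℝ V}
    {S' : LinearMap.BilinForm ℝ V'} (hS : ∀ a b, S' a b = S (A a) (A b)) :
    metricTrace B' (fun a b ↦ S' a b) = metricTrace B (fun a b ↦ S a b) := by
  have hn := nondegenerate_comp_equiv hB hs A hB'
  rw [metricTrace_eq_trace hB hs, metricTrace_eq_trace hn fun a b ↦ by rw [hB', hB', hs],
    ← LinearMap.trace_conj' (raise B S) A.symm]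
  congr 1
  refine raise_eq hn fun a b ↦ ?_
  simp [LinearEquiv.conj_apply, hB', hS, apply_raise hB]

/-- The trace splits along the orthogonal sum of a unit vector and its complement. -/
theorem metricTrace_eq_restrict_add {B : LinearMap.BilinForm ℝ V} (hB : B.Nondegenerate)
    (hs : ∀ a b, B a b = B b a) {n : V} {e : ℝ} (he : e * e = 1) (hn : B n n = e)
    {T : Submodule ℝ V} (hT : ∀ a, a ∈ T ↔ B n a = 0) (S : LinearMap.BilinForm ℝ V) :
    metricTrace B (fun a b ↦ S a b) =
      metricTrace (B.restrict T) (fun a b : T ↦ S a b) + e * S n n := by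
  let P : V →ₗ[ℝ] T := (LinearMap.id - (LinearMap.toSpanSingleton ℝ V n) ∘ₗ (e • B n)).codRestrict T
    fun a ↦ by
      rw [hT]
      simp only [LinearMap.sub_apply, LinearMap.id_apply, LinearMap.comp_apply,
        LinearMap.toSpanSingleton_apply, LinearMap.smul_apply, map_sub, map_smul, hn, smul_eq_mul]
      linear_combination (-B n a) * he
  have hP : ∀ a, ((P a : T) : V) = a - (e * B n a) • n := fun a ↦ by
    simp [P]
  have hTs : ∀ a b : T, B.restrict T a b = B.restrict T b a := fun a b ↦ hs a b
  have hTn : (B.restrict T).Nondegenerate := by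
    refine nondegenerate_of_symm hTs fun a ha ↦ Subtype.ext (hB.1 _ fun c ↦ ?_)
    have h1 : B a (P c : V) = 0 := ha (P c)
    have h2 : B a n = 0 := by rw [hs]; exact (hT _).1 a.2
    simpa [hP, h2] using h1
  have hST : (fun a b : T ↦ S a b) = fun a b ↦ (S.restrict T) a b := rfl
  rw [hST, metricTrace_eq_trace hB hs, metricTrace_eq_trace hTn hTs]
  have h1 : raise (B.restrict T) (S.restrict T) = P ∘ₗ (raise B S ∘ₗ T.subtype) := by
    refine raise_eq hTn fun a b ↦ ?_
    change B ((P (raise B S b) : T) : V) a = S a b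
    rw [hP, map_sub, map_smul, LinearMap.sub_apply, LinearMap.smul_apply, (hT _).1 a.2,
      smul_zero, sub_zero, apply_raise hB]
  have h2 : raise B S = (raise B S ∘ₗ T.subtype) ∘ₗ P + (e • B n).smulRight (raise B S n) := by
    ext a
    simp [hP]
  conv_lhs => rw [h2]
  rw [map_add, LinearMap.trace_smulRight, h1, LinearMap.trace_comp_comm']
  simp [hs n, apply_raise hB]

section RankOne

variable {B γ : LinearMap.BilinForm ℝ V} {ℓ : V →ₗ[ℝ] ℝ} {ε : ℝ}

theorem nondegenerate_add_rankOne_iff (hB : B.Nondegenerate) (hs : ∀ a b, B a b = B b a)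
    (hε : ε * ε = 1) (hγ : ∀ a b, γ a b = B a b + ε * (ℓ a * ℓ b)) :
    γ.Nondegenerate ↔ ε + ℓ (sharp B ℓ) ≠ 0 := by
  have h1 : ∀ b, γ (sharp B ℓ) b = ε * (ε + ℓ (sharp B ℓ)) * ℓ b := fun b ↦ by
    rw [hγ, apply_sharp hB]; linear_combination (-ℓ b) * hε
  constructor
  · intro hn h0
    have hz : sharp B ℓ = 0 := hn.1 _ fun b ↦ by rw [h1, h0]; ring
    rw [hz, map_zero, add_zero] at h0
    rw [h0] at hε
    norm_num at hε
  · intro h0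
    refine nondegenerate_of_symm (fun a b ↦ by rw [hγ, hγ, hs]; ring) fun a ha ↦ ?_
    have h2 := ha (sharp B ℓ)
    have h3 : ℓ a = 0 := by
      rw [hγ, hs, apply_sharp hB] at h2
      have : (ε + ℓ (sharp B ℓ)) * ℓ a = 0 := by
        linear_combination ε * h2 - ℓ a * ℓ (sharp B ℓ) * hε
      exact (mul_eq_zero.1 this).resolve_left h0
    refine hB.1 _ fun b ↦ ?_
    simpa [hγ, h3] using ha b

theorem sharp_add_rankOne (hB : B.Nondegenerate) (hs : ∀ a b, B a b = B b a)
    (hε : ε * ε = 1) (hγ : ∀ a b, γ a b = B a b + ε * (ℓ a * ℓ b))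
    (h0 : ε + ℓ (sharp B ℓ) ≠ 0) (k : V →ₗ[ℝ] ℝ) :
    sharp γ k = sharp B k - (k (sharp B ℓ) / (ε + ℓ (sharp B ℓ))) • sharp B ℓ := by
  refine sharp_eq ((nondegenerate_add_rankOne_iff hB hs hε hγ).2 h0) fun w ↦ ?_
  have hk : ℓ (sharp B k) = k (sharp B ℓ) := by
    rw [← apply_sharp hB ℓ, hs, apply_sharp hB]
  have hc : k (sharp B ℓ) / (ε + ℓ (sharp B ℓ)) * (ε + ℓ (sharp B ℓ)) = k (sharp B ℓ) :=
    div_mul_cancel₀ _ h0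
  simp only [hγ, map_sub, map_smul, LinearMap.sub_apply, LinearMap.smul_apply, smul_eq_mul,
    apply_sharp hB, hk]
  linear_combination (-ε * ℓ w) * hc + (k (sharp B ℓ) / (ε + ℓ (sharp B ℓ))) * ℓ w * hε

theorem metricTrace_add_rankOne (hB : B.Nondegenerate) (hs : ∀ a b, B a b = B b a)
    (hε : ε * ε = 1) (hγ : ∀ a b, γ a b = B a b + ε * (ℓ a * ℓ b))
    (h0 : ε + ℓ (sharp B ℓ) ≠ 0) (S : LinearMap.BilinForm ℝ V) :
    metricTrace γ (fun a b ↦ S a b) = metricTrace B (fun a b ↦ S a b) -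
      S (sharp B ℓ) (sharp B ℓ) / (ε + ℓ (sharp B ℓ)) := by
  have h2 : S (sharp B ℓ) (sharp B ℓ) =
      ∑ i, (Module.finBasis ℝ V).coord i (sharp B ℓ) * S (sharp B ℓ) (Module.finBasis ℝ V i) := by
    have h := congrArg (S (sharp B ℓ)) ((Module.finBasis ℝ V).sum_repr (sharp B ℓ))
    simp only [map_sum, map_smul, smul_eq_mul] at h
    exact h.symm
  rw [metricTrace, metricTrace, h2, Finset.sum_div, ← Finset.sum_sub_distrib]
  refine Finset.sum_congr rfl fun i _ ↦ ?_
  rw [sharp_add_rankOne hB hs hε hγ h0]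
  simp only [map_sub, map_smul, LinearMap.sub_apply, LinearMap.smul_apply, smul_eq_mul]
  ring

end RankOne

end LinearAlgebra

section Local

variable {E : Type*} [NormedAddCommGroup E] [NormedSpace ℝ E]

/-- The Koszul functional `(∂ₐ g(b, ·) + ∂_b g(a, ·) - ∂ g(a, b)) / 2`. -/
def koszul (D : E →L[ℝ] E →L[ℝ] E →L[ℝ] ℝ) (a b : E) : E →L[ℝ] ℝ :=
  (1 / 2 : ℝ) • (D a b + D b a - (D.flip a).flip b)

theorem koszul_apply (D : E →L[ℝ] E →L[ℝ] E →L[ℝ] ℝ) (a b c : E) :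
    koszul D a b c = 1 / 2 * (D a b c + D b a c - D c a b) := by
  simp [koszul]

theorem fderiv_bilin_apply {G : E → E →L[ℝ] E →L[ℝ] ℝ} {y : E} (hG : DifferentiableAt ℝ G y)
    {X Y : E → E} (hX : DifferentiableAt ℝ X y) (hY : DifferentiableAt ℝ Y y) (a : E) :
    fderiv ℝ (fun z ↦ G z (X z) (Y z)) y a =
      fderiv ℝ G y a (X y) (Y y) + G y (fderiv ℝ X y a) (Y y) + G y (X y) (fderiv ℝ Y y a) := by
  rw [((hG.hasFDerivAt.clm_apply hX.hasFDerivAt).clm_apply hY.hasFDerivAt).fderiv]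
  simp
  ring

theorem fderiv_symm_apply {G : E → E →L[ℝ] E →L[ℝ] ℝ} {y : E} (hG : DifferentiableAt ℝ G y)
    (hs : ∀ᶠ z in 𝓝 y, ∀ a b, G z a b = G z b a) (a b c : E) :
    fderiv ℝ G y a b c = fderiv ℝ G y a c b := by
  have h : (fun z ↦ G z b c) =ᶠ[𝓝 y] fun z ↦ G z c b := hs.mono fun z hz ↦ hz b c
  have h1 := fderiv_bilin_apply hG (differentiableAt_const b) (differentiableAt_const c) a
  have h2 := fderiv_bilin_apply hG (differentiableAt_const c) (differentiableAt_const b) a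
  rw [h.fderiv_eq] at h1
  simpa using h1.symm.trans h2

variable [FiniteDimensional ℝ E]

/-- The Hessian of `U` at `y` for the metric `G` on a normed space. -/
def localHess (G : E → E →L[ℝ] E →L[ℝ] ℝ) (U : E → ℝ) (y : E) : LinearMap.BilinForm ℝ E :=
  LinearMap.mk₂ ℝ (fun a b ↦ fderiv ℝ (fderiv ℝ U) y a b -
      fderiv ℝ U y (sharpₗ (G y).toBilinForm (koszul (fderiv ℝ G y) a b).toLinearMap))
    (fun a a' b ↦ by
      have : (koszul (fderiv ℝ G y) (a + a') b).toLinearMap =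
          (koszul (fderiv ℝ G y) a b).toLinearMap + (koszul (fderiv ℝ G y) a' b).toLinearMap := by
        ext c; simp [koszul_apply]; ring
      simp only [this, map_add, _root_.add_apply]; ring)
    (fun r a b ↦ by
      have : (koszul (fderiv ℝ G y) (r • a) b).toLinearMap =
          r • (koszul (fderiv ℝ G y) a b).toLinearMap := by
        ext c; simp [koszul_apply]; ring
      simp only [this, map_smul, _root_.smul_apply, smul_sub])
    (fun a b b' ↦ by
      have : (koszul (fderiv ℝ G y) a (b + b')).toLinearMap =
          (koszul (fderiv ℝ G y) a b).toLinearMap + (koszul (fderiv ℝ G y) a b').toLinearMap := by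
        ext c; simp [koszul_apply]; ring
      simp only [this, map_add]; ring)
    (fun r a b ↦ by
      have : (koszul (fderiv ℝ G y) a (r • b)).toLinearMap =
          r • (koszul (fderiv ℝ G y) a b).toLinearMap := by
        ext c; simp [koszul_apply]; ring
      simp only [this, map_smul, smul_sub])

theorem localHess_apply (G : E → E →L[ℝ] E →L[ℝ] ℝ) (U : E → ℝ) (y a b : E) :
    localHess G U y a b = fderiv ℝ (fderiv ℝ U) y a b -
      fderiv ℝ U y (sharp (G y).toBilinForm (koszul (fderiv ℝ G y) a b).toLinearMap) := rfl

/-- The Hessian is natural under `C²` changes of coordinates. -/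
theorem localHess_comp {G G' : E → E →L[ℝ] E →L[ℝ] ℝ} {U U' : E → ℝ} {ψ : E → E} {y : E}
    (hψ : ContDiffAt ℝ 2 ψ y) (A : E ≃ₗ[ℝ] E) (hA : ∀ a, fderiv ℝ ψ y a = A a)
    (hG : DifferentiableAt ℝ G (ψ y)) (hU : ContDiffAt ℝ 2 U (ψ y))
    (hn : (G (ψ y)).toBilinForm.Nondegenerate) (hs : ∀ a b, G (ψ y) a b = G (ψ y) b a)
    (hG' : ∀ᶠ z in 𝓝 y, ∀ a b, G' z a b = G (ψ z) (fderiv ℝ ψ z a) (fderiv ℝ ψ z b))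
    (hdG' : DifferentiableAt ℝ G' y) (hU' : U' =ᶠ[𝓝 y] U ∘ ψ) (a b : E) :
    localHess G' U' y a b = localHess G U (ψ y) (A a) (A b) := by
  have hdψ : DifferentiableAt ℝ ψ y := hψ.differentiableAt (by norm_num)
  have hd2ψ : DifferentiableAt ℝ (fderiv ℝ ψ) y :=
    (hψ.fderiv_right (m := 1) (by norm_num)).differentiableAt (by norm_num)
  have hψs : ∀ a b, fderiv ℝ (fderiv ℝ ψ) y a b = fderiv ℝ (fderiv ℝ ψ) y b a := fun a b ↦
    (hψ.isSymmSndFDerivAt (by simp)).eq a b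
  have hdψa : ∀ b, DifferentiableAt ℝ (fun z ↦ fderiv ℝ ψ z b) y := fun b ↦
    hd2ψ.clm_apply (differentiableAt_const b)
  have hdψa' : ∀ a b, fderiv ℝ (fun z ↦ fderiv ℝ ψ z b) y a = fderiv ℝ (fderiv ℝ ψ) y a b :=
    fun a b ↦ by rw [fderiv_clm_apply hd2ψ (differentiableAt_const b)]; simp
  have hD : ∀ a b c, fderiv ℝ G' y a b c = fderiv ℝ G (ψ y) (A a) (A b) (A c) +
      G (ψ y) (fderiv ℝ (fderiv ℝ ψ) y a b) (A c) +
      G (ψ y) (A b) (fderiv ℝ (fderiv ℝ ψ) y a c) := fun a b c ↦ by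
    have h1 := fderiv_bilin_apply hdG' (differentiableAt_const b) (differentiableAt_const c) a
    have h2 : (fun z ↦ G' z b c) =ᶠ[𝓝 y]
        fun z ↦ (G ∘ ψ) z (fderiv ℝ ψ z b) (fderiv ℝ ψ z c) := hG'.mono fun z hz ↦ hz b c
    have hGψ : DifferentiableAt ℝ (G ∘ ψ) y := hG.comp y hdψ
    have h3 := fderiv_bilin_apply hGψ (hdψa b) (hdψa c) a
    rw [← h2.fderiv_eq, h1, fderiv_comp y hG hdψ] at h3
    simpa [hdψa', hA] using h3
  have hU1 : fderiv ℝ U' =ᶠ[𝓝 y] fun z ↦ (fderiv ℝ U (ψ z)).comp (fderiv ℝ ψ z) := by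
    have e1 : ∀ᶠ z in 𝓝 y, DifferentiableAt ℝ U (ψ z) := by
      have : ∀ᶠ z in 𝓝 (ψ y), ContDiffAt ℝ 2 U z := hU.eventually (by simp)
      exact (hψ.continuousAt.eventually this).mono fun z hz ↦ hz.differentiableAt (by norm_num)
    have e2 : ∀ᶠ z in 𝓝 y, DifferentiableAt ℝ ψ z :=
      (hψ.eventually (by simp)).mono fun z hz ↦ hz.differentiableAt (by norm_num)
    filter_upwards [hU'.fderiv (𝕜 := ℝ), e1, e2] with z h1 h2 h3
    exact h1.trans (fderiv_comp z h2 h3)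
  have hd2U : DifferentiableAt ℝ (fderiv ℝ U) (ψ y) :=
    (hU.fderiv_right (m := 1) (by norm_num)).differentiableAt (by norm_num)
  have hU2 : fderiv ℝ (fderiv ℝ U') y a b = fderiv ℝ (fderiv ℝ U) (ψ y) (A a) (A b) +
      fderiv ℝ U (ψ y) (fderiv ℝ (fderiv ℝ ψ) y a b) := by
    have h : HasFDerivAt (fun z ↦ fderiv ℝ U (ψ z)) _ y := hd2U.hasFDerivAt.comp y hdψ.hasFDerivAt
    rw [hU1.fderiv_eq, (h.clm_comp hd2ψ.hasFDerivAt).fderiv]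
    simp [hA]
    ring
  have hB' : ∀ a b, (G' y).toBilinForm a b = (G (ψ y)).toBilinForm (A a) (A b) := fun a b ↦ by
    have := hG'.self_of_nhds a b
    simpa [hA] using this
  have hn' := nondegenerate_comp_equiv hn hs A hB'
  have hΓ : A (sharp (G' y).toBilinForm (koszul (fderiv ℝ G' y) a b).toLinearMap) =
      sharp (G (ψ y)).toBilinForm (koszul (fderiv ℝ G (ψ y)) (A a) (A b)).toLinearMap +
        fderiv ℝ (fderiv ℝ ψ) y a b := by
    refine eq_of_forall_apply hn fun c ↦ ?_
    obtain ⟨c, rfl⟩ := A.surjective c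
    rw [← hB', apply_sharp hn', map_add, LinearMap.add_apply, apply_sharp hn]
    change koszul _ _ _ _ = koszul _ _ _ _ + G (ψ y) _ _
    rw [koszul_apply, koszul_apply, hD, hD, hD, hψs b a, hψs c a, hψs c b,
      hs (A b), hs (A a)]
    ring
  rw [localHess_apply, localHess_apply, hU2, hU1.self_of_nhds, ContinuousLinearMap.comp_apply, hA,
    hΓ, map_add]
  ring

/-- The Hessian of a composite `φ ∘ U`. -/
theorem localHess_scomp {G : E → E →L[ℝ] E →L[ℝ] ℝ} {U : E → ℝ} {φ : ℝ → ℝ} {y : E}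
    (hU : ContDiffAt ℝ 2 U y) (hφ : ContDiffAt ℝ 2 φ (U y)) (a b : E) :
    localHess G (φ ∘ U) y a b =
      deriv (deriv φ) (U y) * (fderiv ℝ U y a * fderiv ℝ U y b) +
        deriv φ (U y) * localHess G U y a b := by
  have hU1 : fderiv ℝ (φ ∘ U) =ᶠ[𝓝 y] fun z ↦ deriv φ (U z) • fderiv ℝ U z := by
    have e1 : ∀ᶠ z in 𝓝 y, DifferentiableAt ℝ φ (U z) := by
      have : ∀ᶠ z in 𝓝 (U y), ContDiffAt ℝ 2 φ z := hφ.eventually (by simp)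
      exact (hU.continuousAt.eventually this).mono fun z hz ↦ hz.differentiableAt (by norm_num)
    have e2 : ∀ᶠ z in 𝓝 y, DifferentiableAt ℝ U z :=
      (hU.eventually (by simp)).mono fun z hz ↦ hz.differentiableAt (by norm_num)
    filter_upwards [e1, e2] with z h2 h3
    exact (h2.hasDerivAt.comp_hasFDerivAt z h3.hasFDerivAt).fderiv
  have hdφ : DifferentiableAt ℝ (deriv φ) (U y) := by
    have h := (hφ.fderiv_right (m := 1) (by norm_num)).differentiableAt (by norm_num)
    exact h.clm_apply (differentiableAt_const 1)
  have hdU : DifferentiableAt ℝ U y := hU.differentiableAt (by norm_num)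
  have hd2U : DifferentiableAt ℝ (fderiv ℝ U) y :=
    (hU.fderiv_right (m := 1) (by norm_num)).differentiableAt (by norm_num)
  have h : HasFDerivAt (fun z ↦ deriv φ (U z)) _ y :=
    hdφ.hasDerivAt.comp_hasFDerivAt y hdU.hasFDerivAt
  have h' : HasFDerivAt (fun z ↦ deriv φ (U z) • fderiv ℝ U z) _ y := h.smul hd2U.hasFDerivAt
  rw [localHess_apply, localHess_apply, hU1.fderiv_eq, hU1.self_of_nhds, h'.fderiv]
  simp
  ring

section GradientField

variable {G : E → E →L[ℝ] E →L[ℝ] ℝ} {U : E → ℝ} {Y : E → E} {y : E}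

/-- The covariant derivative of the gradient field of `U` is the Hessian of `U`. -/
theorem apply_covDeriv_gradient (hG : DifferentiableAt ℝ G y)
    (hs : ∀ᶠ z in 𝓝 y, ∀ a b, G z a b = G z b a) (hn : (G y).toBilinForm.Nondegenerate)
    (hY : DifferentiableAt ℝ Y y) (hYU : ∀ᶠ z in 𝓝 y, ∀ c, G z (Y z) c = fderiv ℝ U z c)
    (hU : ContDiffAt ℝ 2 U y) (a b : E) :
    G y (fderiv ℝ Y y a + sharp (G y).toBilinForm (koszul (fderiv ℝ G y) a (Y y)).toLinearMap) b =
      localHess G U y a b := by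
  have hd2U : DifferentiableAt ℝ (fderiv ℝ U) y :=
    (hU.fderiv_right (m := 1) (by norm_num)).differentiableAt (by norm_num)
  have h1 := fderiv_bilin_apply hG hY (differentiableAt_const b) a
  have h2 : (fun z ↦ G z (Y z) b) =ᶠ[𝓝 y] fun z ↦ fderiv ℝ U z b := hYU.mono fun z hz ↦ hz b
  rw [h2.fderiv_eq, fderiv_clm_apply hd2U (differentiableAt_const b)] at h1
  simp at h1
  have h3 : G y (sharp (G y).toBilinForm (koszul (fderiv ℝ G y) a (Y y)).toLinearMap) b =
      koszul (fderiv ℝ G y) a (Y y) b := apply_sharp hn _ b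
  have h4 : G y (sharp (G y).toBilinForm (koszul (fderiv ℝ G y) a b).toLinearMap) (Y y) =
      koszul (fderiv ℝ G y) a b (Y y) := apply_sharp hn _ _
  rw [localHess_apply, ← hYU.self_of_nhds, hs.self_of_nhds (Y y), h4, map_add,
    _root_.add_apply, h3, h1, koszul_apply, koszul_apply,
    fderiv_symm_apply hG hs a b, fderiv_symm_apply hG hs b a]
  ring

/-- If the gradient field has constant length, it is in the kernel of the Hessian. -/
theorem localHess_apply_gradient (hG : DifferentiableAt ℝ G y)
    (hs : ∀ᶠ z in 𝓝 y, ∀ a b, G z a b = G z b a) (hn : (G y).toBilinForm.Nondegenerate)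
    (hY : DifferentiableAt ℝ Y y) (hYU : ∀ᶠ z in 𝓝 y, ∀ c, G z (Y z) c = fderiv ℝ U z c)
    (hU : ContDiffAt ℝ 2 U y) {e : ℝ} (he : ∀ᶠ z in 𝓝 y, G z (Y z) (Y z) = e) (a : E) :
    localHess G U y a (Y y) = 0 := by
  have h1 := fderiv_bilin_apply hG hY hY a
  have h2 : (fun z ↦ G z (Y z) (Y z)) =ᶠ[𝓝 y] fun _ ↦ e := he
  rw [h2.fderiv_eq] at h1
  simp [hs.self_of_nhds (Y y)] at h1
  have h3 : G y (sharp (G y).toBilinForm (koszul (fderiv ℝ G y) a (Y y)).toLinearMap) (Y y) =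
      koszul (fderiv ℝ G y) a (Y y) (Y y) := apply_sharp hn _ _
  rw [← apply_covDeriv_gradient hG hs hn hY hYU hU, map_add, _root_.add_apply, h3,
    koszul_apply, fderiv_symm_apply hG hs (Y y) a]
  linear_combination (-1 / 2) * h1

end GradientField

section Inverse

theorem exists_equiv_of_nondegenerate {g : E →L[ℝ] E →L[ℝ] ℝ}
    (hg : g.toBilinForm.Nondegenerate) : ∃ e : E ≃L[ℝ] (E →L[ℝ] ℝ), (e : E →L[ℝ] E →L[ℝ] ℝ) = g := by
  refine ⟨((g.toBilinForm.toDual hg).trans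
    (LinearMap.toContinuousLinearMap (E := E) (F' := ℝ))).toContinuousLinearEquiv, ?_⟩
  ext a b
  rfl

theorem sharp_eq_inverse {g : E →L[ℝ] E →L[ℝ] ℝ} (hg : g.toBilinForm.Nondegenerate)
    (k : E →L[ℝ] ℝ) : sharp g.toBilinForm k.toLinearMap = g.inverse k := by
  obtain ⟨e, rfl⟩ := exists_equiv_of_nondegenerate hg
  refine sharp_eq hg fun w ↦ ?_
  rw [ContinuousLinearMap.inverse_equiv]
  change e (e.symm k) w = k w
  rw [e.apply_symm_apply]

theorem contDiffAt_inverse {n : WithTop ℕ∞} {G : E → E →L[ℝ] E →L[ℝ] ℝ} {y : E}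
    (hG : ContDiffAt ℝ n G y) (hn : (G y).toBilinForm.Nondegenerate) :
    ContDiffAt ℝ n (fun z ↦ (G z).inverse) y := by
  have : CompleteSpace E := FiniteDimensional.complete ℝ E
  obtain ⟨e, he⟩ := exists_equiv_of_nondegenerate hn
  have h := contDiffAt_map_inverse (n := n) e
  rw [he] at h
  exact h.comp y hG

theorem continuousAt_metricTrace_localHess {G : E → E →L[ℝ] E →L[ℝ] ℝ} {U : E → ℝ} {y : E}
    (hG : ContDiffAt ℝ 1 G y) (hU : ContDiffAt ℝ 2 U y)
    (hn : ∀ᶠ z in 𝓝 y, (G z).toBilinForm.Nondegenerate) :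
    ContinuousAt (fun z ↦ metricTrace (G z).toBilinForm fun a b ↦ localHess G U z a b) y := by
  have hi : ContinuousAt (fun z ↦ (G z).inverse) y :=
    (contDiffAt_inverse hG hn.self_of_nhds).continuousAt
  have hDG : ContinuousAt (fderiv ℝ G) y :=
    (hG.fderiv_right (m := 0) (by norm_num)).continuousAt
  have hDU : ContinuousAt (fderiv ℝ U) y :=
    (hU.fderiv_right (m := 0) (by norm_num)).continuousAt
  have hD2U : ContinuousAt (fderiv ℝ (fderiv ℝ U)) y :=
    ((hU.fderiv_right (m := 1) (by norm_num)).fderiv_right (m := 0) (by norm_num)).continuousAt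
  let θ : Fin (Module.finrank ℝ E) → E →L[ℝ] ℝ := fun i ↦
    LinearMap.toContinuousLinearMap ((Module.finBasis ℝ E).coord i)
  let e := Module.finBasis ℝ E
  have key : (fun z ↦ metricTrace (G z).toBilinForm fun a b ↦ localHess G U z a b) =ᶠ[𝓝 y]
      fun z ↦ ∑ i, (fderiv ℝ (fderiv ℝ U) z ((G z).inverse (θ i)) (e i) -
        fderiv ℝ U z ((G z).inverse (koszul (fderiv ℝ G z) ((G z).inverse (θ i)) (e i)))) := by
    filter_upwards [hn] with z hz
    rw [metricTrace]
    refine Finset.sum_congr rfl fun i _ ↦ ?_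
    have : sharp (G z).toBilinForm ((Module.finBasis ℝ E).coord i) = (G z).inverse (θ i) :=
      sharp_eq_inverse hz (θ i)
    rw [localHess_apply, this, sharp_eq_inverse hz]
  refine ContinuousAt.congr ?_ key.symm
  refine tendsto_finsetSum _ fun i _ ↦ ?_
  have h1 : ContinuousAt (fun z ↦ (G z).inverse (θ i)) y := hi.clm_apply continuousAt_const
  have h2 : ContinuousAt (fun z ↦ koszul (fderiv ℝ G z) ((G z).inverse (θ i)) (e i)) y := by
    refine continuousAt_clm_apply.2 fun c ↦ ?_
    simp only [koszul_apply]
    have h3 : ContinuousAt (fun z ↦ fderiv ℝ G z ((G z).inverse (θ i)) (e i) c) y :=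
      ((hDG.clm_apply h1).clm_apply continuousAt_const).clm_apply continuousAt_const
    have h4 : ContinuousAt (fun z ↦ fderiv ℝ G z (e i) ((G z).inverse (θ i)) c) y :=
      ((hDG.clm_apply continuousAt_const).clm_apply h1).clm_apply continuousAt_const
    have h5 : ContinuousAt (fun z ↦ fderiv ℝ G z c ((G z).inverse (θ i)) (e i)) y :=
      ((hDG.clm_apply continuousAt_const).clm_apply h1).clm_apply continuousAt_const
    exact continuousAt_const.mul ((h3.add h4).sub h5)
  exact ((hD2U.clm_apply h1).clm_apply continuousAt_const).sub
    (hDU.clm_apply (hi.clm_apply h2))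

end Inverse

end Local

section Charts

variable {E : Type*} [NormedAddCommGroup E] [NormedSpace ℝ E]
  {M : Type*} [TopologicalSpace M] [ChartedSpace E M]

theorem contMDiffAt_real_iff {n : WithTop ℕ∞} [IsManifold 𝓘(ℝ, E) n M] {w : M → ℝ} {p x : M}
    (hx : x ∈ (extChartAt 𝓘(ℝ, E) p).source) :
    ContMDiffAt 𝓘(ℝ, E) 𝓘(ℝ, ℝ) n w x ↔
      ContDiffAt ℝ n (w ∘ (extChartAt 𝓘(ℝ, E) p).symm) (extChartAt 𝓘(ℝ, E) p x) := by
  rw [contMDiffAt_iff_source_of_mem_source (x := p) (by simpa using hx)]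
  simp [contMDiffWithinAt_univ, contMDiffAt_iff_contDiffAt]

theorem mfderiv_apply_eq_fderiv {w : M → ℝ} {p : M}
    (hw : MDifferentiableAt 𝓘(ℝ, E) 𝓘(ℝ, ℝ) w p) (a : E) :
    mfderiv 𝓘(ℝ, E) 𝓘(ℝ, ℝ) w p a =
      fderiv ℝ (w ∘ (extChartAt 𝓘(ℝ, E) p).symm) (extChartAt 𝓘(ℝ, E) p p) a := by
  simp only [mfderiv, hw, writtenInExtChartAt, modelWithCornersSelf_coe, Set.range_id,
    fderivWithin_univ, extChartAt_model_space_eq_id]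
  rfl

variable [IsManifold 𝓘(ℝ, E) ∞ M]

theorem contMDiffAt_chart_symm {p : M} {y : E} (hy : y ∈ (extChartAt 𝓘(ℝ, E) p).target) :
    ContMDiffAt 𝓘(ℝ, E) 𝓘(ℝ, E) ∞ (extChartAt 𝓘(ℝ, E) p).symm y :=
  (contMDiffOn_extChartAt_symm p).contMDiffAt ((isOpen_extChartAt_target p).mem_nhds hy)

theorem mdifferentiableAt_chart_symm {p : M} {y : E} (hy : y ∈ (extChartAt 𝓘(ℝ, E) p).target) :
    MDifferentiableAt 𝓘(ℝ, E) 𝓘(ℝ, E) (extChartAt 𝓘(ℝ, E) p).symm y :=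
  (contMDiffAt_chart_symm hy).mdifferentiableAt (by simp)

/-- The derivative of the inverse of a chart, as a linear equivalence. -/
theorem exists_equiv_mfderiv_chart_symm {p : M} {y : E}
    (hy : y ∈ (extChartAt 𝓘(ℝ, E) p).target) :
    ∃ A : E ≃ₗ[ℝ] TangentSpace 𝓘(ℝ, E) ((extChartAt 𝓘(ℝ, E) p).symm y),
      (∀ a : E, mfderiv 𝓘(ℝ, E) 𝓘(ℝ, E) (extChartAt 𝓘(ℝ, E) p).symm y a = A a) ∧
      ∀ v, mfderiv 𝓘(ℝ, E) 𝓘(ℝ, E) (extChartAt 𝓘(ℝ, E) p)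
        ((extChartAt 𝓘(ℝ, E) p).symm y) v = A.symm v := by
  have : IsManifold 𝓘(ℝ, E) 1 M := IsManifold.of_le (n := ∞) (by simp)
  have h1 := mfderivWithin_extChartAt_symm_comp_mfderiv_extChartAt (I := 𝓘(ℝ, E)) hy
  have h2 := mfderiv_extChartAt_comp_mfderivWithin_extChartAt_symm (I := 𝓘(ℝ, E)) hy
  simp only [modelWithCornersSelf_coe, Set.range_id, mfderivWithin_univ] at h1 h2
  refine ⟨LinearEquiv.ofLinearMap
    (mfderiv 𝓘(ℝ, E) 𝓘(ℝ, E) (extChartAt 𝓘(ℝ, E) p).symm y).toLinearMap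
    (mfderiv 𝓘(ℝ, E) 𝓘(ℝ, E) (extChartAt 𝓘(ℝ, E) p)
        ((extChartAt 𝓘(ℝ, E) p).symm y)).toLinearMap ?_ ?_, fun a ↦ rfl, fun v ↦ rfl⟩
  · ext v; exact DFunLike.congr_fun h1 v
  · ext v; exact DFunLike.congr_fun h2 v

theorem mfderiv_chart_symm_self (p : M) (a : E) :
    mfderiv 𝓘(ℝ, E) 𝓘(ℝ, E) (extChartAt 𝓘(ℝ, E) p).symm (extChartAt 𝓘(ℝ, E) p p) a = a := by
  have : IsManifold 𝓘(ℝ, E) 1 M := IsManifold.of_le (n := ∞) (by simp)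
  have h := mfderivWithin_range_extChartAt_symm (I := 𝓘(ℝ, E)) (x := p)
  simp only [modelWithCornersSelf_coe, Set.range_id, mfderivWithin_univ] at h
  exact DFunLike.congr_fun h a

theorem fderiv_comp_chart_symm {w : M → ℝ} {p : M} {y : E}
    (hy : y ∈ (extChartAt 𝓘(ℝ, E) p).target)
    (hw : MDifferentiableAt 𝓘(ℝ, E) 𝓘(ℝ, ℝ) w ((extChartAt 𝓘(ℝ, E) p).symm y)) (a : E) :
    fderiv ℝ (w ∘ (extChartAt 𝓘(ℝ, E) p).symm) y a =
      mfderiv 𝓘(ℝ, E) 𝓘(ℝ, ℝ) w ((extChartAt 𝓘(ℝ, E) p).symm y)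
        (mfderiv 𝓘(ℝ, E) 𝓘(ℝ, E) (extChartAt 𝓘(ℝ, E) p).symm y a) := by
  have h := mfderiv_comp y hw (mdifferentiableAt_chart_symm hy)
  rw [mfderiv_eq_fderiv] at h
  exact DFunLike.congr_fun h a

end Charts

section Metric

variable {E : Type*} [NormedAddCommGroup E] [NormedSpace ℝ E] [FiniteDimensional ℝ E]
  {M : Type*} [TopologicalSpace M] [ChartedSpace E M] [IsManifold 𝓘(ℝ, E) ∞ M]
  {g : TensorField2 𝓘(ℝ, E) M}

theorem metricInChart_apply (p : M) (y a b : E) :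
    metricInChart g p y a b = g ((extChartAt 𝓘(ℝ, E) p).symm y)
      (mfderiv 𝓘(ℝ, E) 𝓘(ℝ, E) (extChartAt 𝓘(ℝ, E) p).symm y a)
      (mfderiv 𝓘(ℝ, E) 𝓘(ℝ, E) (extChartAt 𝓘(ℝ, E) p).symm y b) := rfl

theorem metricInChart_self (p : M) (a b : E) :
    metricInChart g p (extChartAt 𝓘(ℝ, E) p p) a b = g p a b := by
  rw [metricInChart_apply, mfderiv_chart_symm_self, mfderiv_chart_symm_self]
  rw [(extChartAt 𝓘(ℝ, E) p).left_inv (mem_extChartAt_source p)]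

theorem toBilinForm_metricInChart_self (p : M) :
    (metricInChart g p (extChartAt 𝓘(ℝ, E) p p)).toBilinForm = (formAt g p : LinearMap.BilinForm ℝ E) :=
  LinearMap.ext₂ fun a b ↦ metricInChart_self p a b

namespace IsSemiRiemannianMetric

theorem metricInChart_symm (hg : IsSemiRiemannianMetric g) (p : M) (y a b : E) :
    metricInChart g p y a b = metricInChart g p y b a :=
  (metricInChart_apply p y a b).trans
    ((hg.symm _ _ _).trans (metricInChart_apply p y b a).symm)

theorem metricInChart_nondegenerate (hg : IsSemiRiemannianMetric g) {p : M} {y : E} (hy : y ∈ (extChartAt 𝓘(ℝ, E) p).target) :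
    (metricInChart g p y).toBilinForm.Nondegenerate := by
  obtain ⟨A, hA, -⟩ := exists_equiv_mfderiv_chart_symm hy
  refine nondegenerate_comp_equiv (hg.nondegenerate _) (hg.symm _) A fun a b ↦ ?_
  rw [← hA, ← hA]
  rfl

theorem contDiffAt_metricInChart (hg : IsSemiRiemannianMetric g) {p : M} {y : E} (hy : y ∈ (extChartAt 𝓘(ℝ, E) p).target) :
    ContDiffAt ℝ ∞ (metricInChart g p) y := by
  have ht := isOpen_extChartAt_target (I := 𝓘(ℝ, E)) p
  refine ContDiffOn.contDiffAt (s := (extChartAt 𝓘(ℝ, E) p).target) ?_ (ht.mem_nhds hy)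
  have hv : ∀ a : E, ContMDiffOn 𝓘(ℝ, E) (𝓘(ℝ, E).prod 𝓘(ℝ, E)) ∞
      (fun y : E ↦ Bundle.TotalSpace.mk' E (E := fun x : M ↦ TangentSpace 𝓘(ℝ, E) x)
        ((extChartAt 𝓘(ℝ, E) p).symm y)
        (mfderiv 𝓘(ℝ, E) 𝓘(ℝ, E) (extChartAt 𝓘(ℝ, E) p).symm y a))
      (extChartAt 𝓘(ℝ, E) p).target := fun a ↦ by
    have h1 := (contMDiffOn_extChartAt_symm (I := 𝓘(ℝ, E)) (n := ∞) p).contMDiffOn_tangentMapWithin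
      (m := ∞) (by simp) ht.uniqueMDiffOn
    have h2 : ContMDiff 𝓘(ℝ, E) (𝓘(ℝ, E).prod 𝓘(ℝ, E)) ∞
        (fun y : E ↦ (⟨y, a⟩ : TangentBundle 𝓘(ℝ, E) E)) :=
      contMDiff_vectorSpace_iff_contDiff.2 (contDiff_const (c := a))
    refine (h1.comp h2.contMDiffOn fun y hy ↦ hy).congr fun z hz ↦ ?_
    simp only [tangentMapWithin, Function.comp_apply, mfderivWithin_of_isOpen ht hz]
  refine contDiffOn_clm_apply.2 fun a ↦ contDiffOn_clm_apply.2 fun b ↦ ?_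
  rw [← contMDiffOn_iff_contDiffOn]
  intro z hz
  have h3 := ContMDiffWithinAt.clm_bundle_apply₂ (F₃ := ℝ) (E₃ := Bundle.Trivial M ℝ)
    ((hg.smooth.contMDiffAt).comp_contMDiffWithinAt z
    (contMDiffOn_extChartAt_symm (I := 𝓘(ℝ, E)) (n := ∞) p z hz)) (hv a z hz) (hv b z hz)
  exact (Bundle.contMDiffWithinAt_totalSpace.1 h3).2

end IsSemiRiemannianMetric

end Metric

theorem two_le_infty : (2 : WithTop ℕ∞) ≤ ∞ :=
  WithTop.coe_le_coe.2 (le_top : (2 : ℕ∞) ≤ ⊤)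

section Hessian

variable {E : Type*} [NormedAddCommGroup E] [NormedSpace ℝ E] [FiniteDimensional ℝ E]
  {M : Type*} [TopologicalSpace M] [ChartedSpace E M]

/-- The Hessian of a function on a semi-Riemannian manifold, computed in the preferred chart. -/
def hessian (g : TensorField2 𝓘(ℝ, E) M) (u : M → ℝ) (p : M) :
    LinearMap.BilinForm ℝ (TangentSpace 𝓘(ℝ, E) p) :=
  (localHess (metricInChart g p) (u ∘ (extChartAt 𝓘(ℝ, E) p).symm) (extChartAt 𝓘(ℝ, E) p p) :
    LinearMap.BilinForm ℝ E)

/-- The Laplacian: the metric trace of the Hessian. -/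
def laplacian (g : TensorField2 𝓘(ℝ, E) M) (u : M → ℝ) (p : M) : ℝ :=
  metricTrace (formAt g p) fun a b ↦ hessian g u p a b

/-- The differential of a function. -/
def differential (w : M → ℝ) (p : M) : TangentSpace 𝓘(ℝ, E) p →ₗ[ℝ] ℝ :=
  (mfderiv 𝓘(ℝ, E) 𝓘(ℝ, ℝ) w p).toLinearMap

omit [FiniteDimensional ℝ E] in
theorem eventually_mem_target (p : M) :
    ∀ᶠ y in 𝓝 (extChartAt 𝓘(ℝ, E) p p), y ∈ (extChartAt 𝓘(ℝ, E) p).target :=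
  extChartAt_target_mem_nhds p

variable [IsManifold 𝓘(ℝ, E) ∞ M] {g : TensorField2 𝓘(ℝ, E) M}

/-- The metrics in two charts are related by pullback along the change of charts. -/
theorem metricInChart_change {p x : M} {z : E} (hz : z ∈ (extChartAt 𝓘(ℝ, E) x).target)
    (hzp : (extChartAt 𝓘(ℝ, E) x).symm z ∈ (extChartAt 𝓘(ℝ, E) p).source) (a b : E) :
    metricInChart g x z a b =
      metricInChart g p (extChartAt 𝓘(ℝ, E) p ((extChartAt 𝓘(ℝ, E) x).symm z))
        (fderiv ℝ (extChartAt 𝓘(ℝ, E) p ∘ (extChartAt 𝓘(ℝ, E) x).symm) z a)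
        (fderiv ℝ (extChartAt 𝓘(ℝ, E) p ∘ (extChartAt 𝓘(ℝ, E) x).symm) z b) := by
  set ψ : E → E := extChartAt 𝓘(ℝ, E) p ∘ (extChartAt 𝓘(ℝ, E) x).symm with hψ
  have hψz : ψ z = extChartAt 𝓘(ℝ, E) p ((extChartAt 𝓘(ℝ, E) x).symm z) := rfl
  have h1 : (extChartAt 𝓘(ℝ, E) p).symm ∘ ψ =ᶠ[𝓝 z] (extChartAt 𝓘(ℝ, E) x).symm := by
    have : ∀ᶠ y in 𝓝 z, (extChartAt 𝓘(ℝ, E) x).symm y ∈ (extChartAt 𝓘(ℝ, E) p).source :=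
      (contMDiffAt_chart_symm hz).continuousAt ((isOpen_extChartAt_source p).mem_nhds hzp)
    filter_upwards [this] with y hy
    exact (extChartAt 𝓘(ℝ, E) p).left_inv hy
  have hz' : ψ z ∈ (extChartAt 𝓘(ℝ, E) p).target := (extChartAt 𝓘(ℝ, E) p).map_source hzp
  have hdψ : MDifferentiableAt 𝓘(ℝ, E) 𝓘(ℝ, E) ψ z := by
    have : IsManifold 𝓘(ℝ, E) 1 M := IsManifold.of_le (n := ∞) (by simp)
    exact MDifferentiableAt.comp z (mdifferentiableAt_extChartAt (by simpa using hzp))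
      (mdifferentiableAt_chart_symm hz)
  have h2 : ∀ c : E, mfderiv 𝓘(ℝ, E) 𝓘(ℝ, E) (extChartAt 𝓘(ℝ, E) x).symm z c =
      mfderiv 𝓘(ℝ, E) 𝓘(ℝ, E) (extChartAt 𝓘(ℝ, E) p).symm (ψ z) (fderiv ℝ ψ z c) := fun c ↦ by
    have h3 := mfderiv_comp z (mdifferentiableAt_chart_symm hz') hdψ
    rw [mfderiv_eq_fderiv] at h3
    exact (DFunLike.congr_fun h1.mfderiv_eq c).symm.trans (DFunLike.congr_fun h3 c)
  rw [metricInChart_apply, metricInChart_apply, ← hψz, h2, h2]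
  have h4 : (extChartAt 𝓘(ℝ, E) p).symm (ψ z) = (extChartAt 𝓘(ℝ, E) x).symm z := h1.self_of_nhds
  have h5 : ∀ (x x' : M) (_ : x = x') (a b : E), (g x : E →L[ℝ] E →L[ℝ] ℝ) a b =
      (g x' : E →L[ℝ] E →L[ℝ] ℝ) a b := by
    rintro x _ rfl a b; rfl
  exact h5 _ _ h4.symm _ _

omit [FiniteDimensional ℝ E] in
theorem contDiffAt_chart_change {p x : M} (hx : x ∈ (extChartAt 𝓘(ℝ, E) p).source) :
    ContDiffAt ℝ ∞ (extChartAt 𝓘(ℝ, E) p ∘ (extChartAt 𝓘(ℝ, E) x).symm)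
      (extChartAt 𝓘(ℝ, E) x x) := by
  rw [← contMDiffAt_iff_contDiffAt]
  refine ContMDiffAt.comp (I' := 𝓘(ℝ, E)) _ ?_ (contMDiffAt_chart_symm (mem_extChartAt_target x))
  rw [(extChartAt 𝓘(ℝ, E) x).left_inv (mem_extChartAt_source x)]
  exact contMDiffAt_extChartAt' (by simpa using hx)

/-- The Laplacian can be computed in any of the preferred charts. -/
theorem laplacian_eq_of_mem_source (hg : IsSemiRiemannianMetric g) {u : M → ℝ} {p x : M}
    (hx : x ∈ (extChartAt 𝓘(ℝ, E) p).source) (hu : ContMDiffAt 𝓘(ℝ, E) 𝓘(ℝ, ℝ) 2 u x) :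
    laplacian g u x = metricTrace (metricInChart g p (extChartAt 𝓘(ℝ, E) p x)).toBilinForm
      fun a b ↦ localHess (metricInChart g p) (u ∘ (extChartAt 𝓘(ℝ, E) p).symm)
        (extChartAt 𝓘(ℝ, E) p x) a b := by
  set ψ : E → E := extChartAt 𝓘(ℝ, E) p ∘ (extChartAt 𝓘(ℝ, E) x).symm with hψdef
  set y := extChartAt 𝓘(ℝ, E) x x with hy
  have hyx : (extChartAt 𝓘(ℝ, E) x).symm y = x :=
    (extChartAt 𝓘(ℝ, E) x).left_inv (mem_extChartAt_source x)
  have hψy : ψ y = extChartAt 𝓘(ℝ, E) p x := by rw [hψdef, Function.comp_apply, hyx]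
  have hψ : ContDiffAt ℝ 2 ψ y := (contDiffAt_chart_change hx).of_le two_le_infty
  have hyt : y ∈ (extChartAt 𝓘(ℝ, E) x).target := mem_extChartAt_target x
  have hψt : ψ y ∈ (extChartAt 𝓘(ℝ, E) p).target := hψy ▸ (extChartAt 𝓘(ℝ, E) p).map_source hx
  have hev : ∀ᶠ z in 𝓝 y, z ∈ (extChartAt 𝓘(ℝ, E) x).target ∧
      (extChartAt 𝓘(ℝ, E) x).symm z ∈ (extChartAt 𝓘(ℝ, E) p).source :=
    (eventually_mem_target x).and ((contMDiffAt_chart_symm hyt).continuousAt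
      ((isOpen_extChartAt_source p).mem_nhds (hyx.symm ▸ hx)))
  have hG' : ∀ᶠ z in 𝓝 y, ∀ a b, metricInChart g x z a b =
      metricInChart g p (ψ z) (fderiv ℝ ψ z a) (fderiv ℝ ψ z b) :=
    hev.mono fun z hz a b ↦ metricInChart_change hz.1 hz.2 a b
  have hn' := hg.metricInChart_nondegenerate hyt
  have hn := hg.metricInChart_nondegenerate hψt
  have hinj : Function.Injective (fderiv ℝ ψ y).toLinearMap := by
    rw [← LinearMap.ker_eq_bot, LinearMap.ker_eq_bot']
    intro a ha
    refine hn'.1 a fun b ↦ ?_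
    have h := hG'.self_of_nhds a b
    have ha' : fderiv ℝ ψ y a = 0 := ha
    rw [ha', map_zero, _root_.zero_apply] at h
    exact h
  let A : E ≃ₗ[ℝ] E := LinearEquiv.ofInjectiveEndo _ hinj
  have hA : ∀ a, fderiv ℝ ψ y a = A a := fun a ↦ rfl
  have hU : ContDiffAt ℝ 2 (u ∘ (extChartAt 𝓘(ℝ, E) p).symm) (ψ y) := by
    have : IsManifold 𝓘(ℝ, E) 2 M := IsManifold.of_le (n := ∞) two_le_infty
    rw [hψy]
    exact (contMDiffAt_real_iff hx).1 hu
  have hU' : u ∘ (extChartAt 𝓘(ℝ, E) x).symm =ᶠ[𝓝 y]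
      (u ∘ (extChartAt 𝓘(ℝ, E) p).symm) ∘ ψ := hev.mono fun z hz ↦ by
    simp only [hψdef, Function.comp_apply, (extChartAt 𝓘(ℝ, E) p).left_inv hz.2]
  have hloc := localHess_comp hψ A hA
    ((hg.contDiffAt_metricInChart hψt).differentiableAt (by simp)) hU hn
    (hg.metricInChart_symm p (ψ y)) hG'
    ((hg.contDiffAt_metricInChart hyt).differentiableAt (by simp)) hU'
  rw [← hψy, ← metricTrace_comp_equiv hn (hg.metricInChart_symm p (ψ y)) A
    (fun a b ↦ hG'.self_of_nhds a b) hloc]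
  exact (congrArg (fun B : LinearMap.BilinForm ℝ E ↦ metricTrace B fun a b ↦
    localHess (metricInChart g x) (u ∘ (extChartAt 𝓘(ℝ, E) x).symm) y a b)
    (toBilinForm_metricInChart_self x)).symm

theorem continuous_laplacian (hg : IsSemiRiemannianMetric g) {u : M → ℝ}
    (hu : ContMDiff 𝓘(ℝ, E) 𝓘(ℝ, ℝ) 2 u) : Continuous (laplacian g u) := by
  have : IsManifold 𝓘(ℝ, E) 2 M := IsManifold.of_le (n := ∞) two_le_infty
  refine continuous_iff_continuousAt.2 fun p ↦ ?_
  have h1 : laplacian g u =ᶠ[𝓝 p] (fun y ↦ metricTrace (metricInChart g p y).toBilinForm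
      fun a b ↦ localHess (metricInChart g p) (u ∘ (extChartAt 𝓘(ℝ, E) p).symm) y a b) ∘
        extChartAt 𝓘(ℝ, E) p :=
    Filter.mem_of_superset (extChartAt_source_mem_nhds p) fun x hx ↦ laplacian_eq_of_mem_source hg hx (hu x)
  refine ContinuousAt.congr (ContinuousAt.comp ?_ (continuousAt_extChartAt p)) h1.symm
  refine continuousAt_metricTrace_localHess
    ((hg.contDiffAt_metricInChart (mem_extChartAt_target p)).of_le (by simp))
    ((contMDiffAt_real_iff (mem_extChartAt_source p)).1 (hu p)) ?_
  exact (eventually_mem_target p).mono fun y hy ↦ hg.metricInChart_nondegenerate hy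

/-- The coordinate expression of the gradient. -/
theorem gradient_chart_symm (hg : IsSemiRiemannianMetric g) {w : M → ℝ} {p : M} {y : E}
    (hy : y ∈ (extChartAt 𝓘(ℝ, E) p).target)
    (hw : MDifferentiableAt 𝓘(ℝ, E) 𝓘(ℝ, ℝ) w ((extChartAt 𝓘(ℝ, E) p).symm y)) :
    gradient g w ((extChartAt 𝓘(ℝ, E) p).symm y) =
      mfderiv 𝓘(ℝ, E) 𝓘(ℝ, E) (extChartAt 𝓘(ℝ, E) p).symm y
        ((metricInChart g p y).inverse (fderiv ℝ (w ∘ (extChartAt 𝓘(ℝ, E) p).symm) y)) := by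
  obtain ⟨A, hA, -⟩ := exists_equiv_mfderiv_chart_symm hy
  rw [← sharp_eq_inverse (hg.metricInChart_nondegenerate hy)]
  rw [hA, gradient]
  refine (sharp_comp_equiv (hg.nondegenerate _) (hg.symm _) A (fun a b ↦ ?_) fun a ↦ ?_).symm
  · rw [← hA, ← hA]; rfl
  · rw [← hA]; exact fderiv_comp_chart_symm hy hw a

theorem gradNormSq_chart_symm (hg : IsSemiRiemannianMetric g) {w : M → ℝ} {p : M} {y : E}
    (hy : y ∈ (extChartAt 𝓘(ℝ, E) p).target)
    (hw : MDifferentiableAt 𝓘(ℝ, E) 𝓘(ℝ, ℝ) w ((extChartAt 𝓘(ℝ, E) p).symm y)) :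
    gradNormSq g w ((extChartAt 𝓘(ℝ, E) p).symm y) =
      metricInChart g p y
        ((metricInChart g p y).inverse (fderiv ℝ (w ∘ (extChartAt 𝓘(ℝ, E) p).symm) y))
        ((metricInChart g p y).inverse (fderiv ℝ (w ∘ (extChartAt 𝓘(ℝ, E) p).symm) y)) := by
  rw [gradNormSq, gradient_chart_symm hg hy hw]
  rfl

theorem contDiffAt_gradient_chart (hg : IsSemiRiemannianMetric g) {w : M → ℝ} {p : M}
    (hw : ContMDiff 𝓘(ℝ, E) 𝓘(ℝ, ℝ) 2 w) :
    ContDiffAt ℝ 1 (fun y ↦ (metricInChart g p y).inverse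
      (fderiv ℝ (w ∘ (extChartAt 𝓘(ℝ, E) p).symm) y)) (extChartAt 𝓘(ℝ, E) p p) := by
  have : IsManifold 𝓘(ℝ, E) 2 M := IsManifold.of_le (n := ∞) two_le_infty
  have ht := mem_extChartAt_target (I := 𝓘(ℝ, E)) p
  have h1 := (contMDiffAt_real_iff (mem_extChartAt_source p)).1 (hw p)
  exact (contDiffAt_inverse ((hg.contDiffAt_metricInChart ht).of_le (by simp))
    (hg.metricInChart_nondegenerate ht)).clm_apply (h1.fderiv_right (by norm_num))

theorem contMDiff_gradNormSq (hg : IsSemiRiemannianMetric g) {w : M → ℝ}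
    (hw : ContMDiff 𝓘(ℝ, E) 𝓘(ℝ, ℝ) 2 w) :
    ContMDiff 𝓘(ℝ, E) 𝓘(ℝ, ℝ) 1 (gradNormSq g w) := fun p ↦ by
  have : IsManifold 𝓘(ℝ, E) 1 M := IsManifold.of_le (n := ∞) (by simp)
  have ht := mem_extChartAt_target (I := 𝓘(ℝ, E)) p
  rw [contMDiffAt_real_iff (mem_extChartAt_source p)]
  have hY := contDiffAt_gradient_chart hg (p := p) hw
  refine ((((hg.contDiffAt_metricInChart ht).of_le (by simp)).clm_apply hY).clm_apply
    hY).congr_of_eventuallyEq ?_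
  exact (eventually_mem_target p).mono fun y hy ↦
    gradNormSq_chart_symm hg hy (hw.mdifferentiable (by norm_num) _)

section Gradient

variable {w : M → ℝ} {p : M}

theorem gradient_eq_chart (hg : IsSemiRiemannianMetric g) (hw : ContMDiff 𝓘(ℝ, E) 𝓘(ℝ, ℝ) 2 w) :
    (gradient g w p : E) = (metricInChart g p (extChartAt 𝓘(ℝ, E) p p)).inverse
      (fderiv ℝ (w ∘ (extChartAt 𝓘(ℝ, E) p).symm) (extChartAt 𝓘(ℝ, E) p p)) := by
  rw [← sharp_eq_inverse (hg.metricInChart_nondegenerate (mem_extChartAt_target p)),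
    toBilinForm_metricInChart_self]
  have : (fderiv ℝ (w ∘ (extChartAt 𝓘(ℝ, E) p).symm) (extChartAt 𝓘(ℝ, E) p p)).toLinearMap =
      (mfderiv 𝓘(ℝ, E) 𝓘(ℝ, ℝ) w p).toLinearMap :=
    LinearMap.ext fun a ↦ (mfderiv_apply_eq_fderiv (hw.mdifferentiable (by norm_num) p) a).symm
  rw [this]
  rfl

theorem apply_gradient (hg : IsSemiRiemannianMetric g) (w : M → ℝ) (p : M)
    (a : TangentSpace 𝓘(ℝ, E) p) :
    g p (gradient g w p) a = differential w p a :=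
  apply_sharp (hg.nondegenerate p) _ a

theorem eventually_apply_gradient_chart (hg : IsSemiRiemannianMetric g) (w : M → ℝ) (p : M) :
    ∀ᶠ z in 𝓝 (extChartAt 𝓘(ℝ, E) p p), ∀ c, metricInChart g p z
      ((metricInChart g p z).inverse (fderiv ℝ (w ∘ (extChartAt 𝓘(ℝ, E) p).symm) z)) c =
        fderiv ℝ (w ∘ (extChartAt 𝓘(ℝ, E) p).symm) z c := by
  filter_upwards [eventually_mem_target p] with z hz c
  have hn := hg.metricInChart_nondegenerate hz
  rw [← sharp_eq_inverse hn]
  exact apply_sharp hn _ c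

theorem apply_covDeriv_gradient_eq_hessian (hg : IsSemiRiemannianMetric g)
    (hw : ContMDiff 𝓘(ℝ, E) 𝓘(ℝ, ℝ) 2 w) (a b : TangentSpace 𝓘(ℝ, E) p) :
    g p (covDeriv g (gradient g w) p a) b = hessian g w p a b := by
  have : IsManifold 𝓘(ℝ, E) 2 M := IsManifold.of_le (n := ∞) two_le_infty
  have ht := mem_extChartAt_target (I := 𝓘(ℝ, E)) p
  have hloc := apply_covDeriv_gradient
    ((hg.contDiffAt_metricInChart ht).differentiableAt (by simp))
    (Eventually.of_forall (hg.metricInChart_symm p)) (hg.metricInChart_nondegenerate ht)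
    ((contDiffAt_gradient_chart hg hw).differentiableAt (by norm_num))
    (eventually_apply_gradient_chart hg w p)
    ((contMDiffAt_real_iff (mem_extChartAt_source p)).1 (hw p)) a b
  have h3 := (metricInChart_self (g := g) p _ b).symm.trans hloc
  have hY : (fun y ↦ mfderiv 𝓘(ℝ, E) 𝓘(ℝ, E) (extChartAt 𝓘(ℝ, E) p)
      ((extChartAt 𝓘(ℝ, E) p).symm y) (gradient g w ((extChartAt 𝓘(ℝ, E) p).symm y)) : E → E)
      =ᶠ[𝓝 (extChartAt 𝓘(ℝ, E) p p)] fun y ↦ (metricInChart g p y).inverse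
        (fderiv ℝ (w ∘ (extChartAt 𝓘(ℝ, E) p).symm) y) := by
    filter_upwards [eventually_mem_target p] with y hy
    obtain ⟨A, hA, hA'⟩ := exists_equiv_mfderiv_chart_symm hy
    rw [gradient_chart_symm hg hy (hw.mdifferentiable (by norm_num) _), hA', hA]
    exact A.symm_apply_apply _
  have h2 : (covDeriv g (gradient g w) p a : E) =
      fderiv ℝ (fun y ↦ (metricInChart g p y).inverse
        (fderiv ℝ (w ∘ (extChartAt 𝓘(ℝ, E) p).symm) y)) (extChartAt 𝓘(ℝ, E) p p) a +
      sharp (metricInChart g p (extChartAt 𝓘(ℝ, E) p p)).toBilinForm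
        (koszul (fderiv ℝ (metricInChart g p) (extChartAt 𝓘(ℝ, E) p p)) a
          ((metricInChart g p (extChartAt 𝓘(ℝ, E) p p)).inverse
      (fderiv ℝ (w ∘ (extChartAt 𝓘(ℝ, E) p).symm) (extChartAt 𝓘(ℝ, E) p p)))).toLinearMap := by
    rw [← hY.fderiv_eq, ← gradient_eq_chart hg hw, toBilinForm_metricInChart_self]
    rfl
  exact (congrArg (fun c : E ↦ g p c b) h2).trans h3

theorem hessian_apply_gradient (hg : IsSemiRiemannianMetric g)
    (hw : ContMDiff 𝓘(ℝ, E) 𝓘(ℝ, ℝ) 2 w) {e : ℝ} (he : ∀ x, gradNormSq g w x = e)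
    (a : TangentSpace 𝓘(ℝ, E) p) : hessian g w p a (gradient g w p) = 0 := by
  have : IsManifold 𝓘(ℝ, E) 2 M := IsManifold.of_le (n := ∞) two_le_infty
  have ht := mem_extChartAt_target (I := 𝓘(ℝ, E)) p
  have hloc := localHess_apply_gradient
    ((hg.contDiffAt_metricInChart ht).differentiableAt (by simp))
    (Eventually.of_forall (hg.metricInChart_symm p)) (hg.metricInChart_nondegenerate ht)
    ((contDiffAt_gradient_chart hg hw).differentiableAt (by norm_num))
    (eventually_apply_gradient_chart hg w p)
    ((contMDiffAt_real_iff (mem_extChartAt_source p)).1 (hw p)) (e := e)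
    ((eventually_mem_target p).mono fun y hy ↦ by
      rw [← gradNormSq_chart_symm hg hy (hw.mdifferentiable (by norm_num) _), he]) a
  rw [← gradient_eq_chart hg hw] at hloc
  exact hloc

theorem hessian_comp (g : TensorField2 𝓘(ℝ, E) M) (hw : ContMDiff 𝓘(ℝ, E) 𝓘(ℝ, ℝ) 2 w) {f : ℝ → ℝ}
    (hf : ContDiffAt ℝ 2 f (w p)) (a b : TangentSpace 𝓘(ℝ, E) p) :
    hessian g (f ∘ w) p a b =
      deriv (deriv f) (w p) *
        (differential w p a * differential w p b) +
      deriv f (w p) * hessian g w p a b := by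
  have : IsManifold 𝓘(ℝ, E) 2 M := IsManifold.of_le (n := ∞) two_le_infty
  have hp : (w ∘ (extChartAt 𝓘(ℝ, E) p).symm) (extChartAt 𝓘(ℝ, E) p p) = w p := by
    rw [Function.comp_apply, (extChartAt 𝓘(ℝ, E) p).left_inv (mem_extChartAt_source p)]
  have hloc := localHess_scomp (G := metricInChart g p)
    ((contMDiffAt_real_iff (mem_extChartAt_source p)).1 (hw p)) (φ := f) (hp ▸ hf) a b
  rw [hp] at hloc
  have hd := hw.mdifferentiable (by norm_num) p
  have hd' : ∀ a, differential w p a = _ := fun a ↦ mfderiv_apply_eq_fderiv hd a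
  rw [hd', hd']
  exact hloc

/-- The mean curvature of the level sets of `q` is the Laplacian of any function `w` whose gradient
is the unit normal. -/
theorem levelMeanCurvature_eq_laplacian (hg : IsSemiRiemannianMetric g)
    (hw : ContMDiff 𝓘(ℝ, E) 𝓘(ℝ, ℝ) 2 w) {q : M → ℝ} (hq : unitNormal g q = gradient g w)
    (hqw : ∀ a : TangentSpace 𝓘(ℝ, E) p, differential q p a = 0 ↔ differential w p a = 0)
    {e : ℝ} (hee : e * e = 1) (he : ∀ x, gradNormSq g w x = e) :
    levelMeanCurvature g q p = laplacian g w p := by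
  rw [laplacian, metricTrace_eq_restrict_add (hg.nondegenerate p) (hg.symm p) hee (he p)
    (T := LinearMap.ker (mfderiv 𝓘(ℝ, E) 𝓘(ℝ, ℝ) q p).toLinearMap), hessian_apply_gradient hg hw he,
    mul_zero, add_zero, levelMeanCurvature, hq]
  · congr 1
    funext a b
    exact apply_covDeriv_gradient_eq_hessian hg hw _ _
  · intro a
    rw [LinearMap.mem_ker]
    exact (hqw a).trans (by rw [← apply_gradient hg]; rfl)

end Gradient

end Hessian

section GraphAlgebra

variable {V : Type*} [AddCommGroup V] [Module ℝ V] [FiniteDimensional ℝ V]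
  {B γ : LinearMap.BilinForm ℝ V} {ℓ : V →ₗ[ℝ] ℝ} {ε : ℝ}

/-- The component of `(z, ζ)` normal to the graph of `ℓ`. -/
theorem sub_sharp_graph (hB : B.Nondegenerate) (hs : ∀ a b, B a b = B b a)
    (hε : ε * ε = 1) (hγ : ∀ a b, γ a b = B a b + ε * (ℓ a * ℓ b))
    (h0 : ε + ℓ (sharp B ℓ) ≠ 0) (z : V) (ζ : ℝ) {k : V →ₗ[ℝ] ℝ}
    (hk : ∀ a, k a = B z a + ε * (ζ * ℓ a)) :
    ((z, ζ) : V × ℝ) - (sharp γ k, ℓ (sharp γ k)) =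
      ((ℓ z - ζ) / (ε + ℓ (sharp B ℓ))) • ((sharp B ℓ, -ε) : V × ℝ) := by
  have hz : sharp B k = z + (ε * ζ) • sharp B ℓ := sharp_eq hB fun w ↦ by
    simp only [map_add, map_smul, LinearMap.add_apply, LinearMap.smul_apply, apply_sharp hB, hk,
      smul_eq_mul]
    ring
  have hkn : k (sharp B ℓ) = ℓ z + ε * ζ * ℓ (sharp B ℓ) := by
    rw [hk, hs, apply_sharp hB]; ring
  have hw : sharp γ k = z - ((ℓ z - ζ) / (ε + ℓ (sharp B ℓ))) • sharp B ℓ := by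
    rw [sharp_add_rankOne hB hs hε hγ h0, hz, hkn, add_sub_assoc, ← sub_smul, sub_eq_add_neg z,
      ← neg_smul]
    congr 2
    field_simp
    linear_combination ζ * hε
  rw [hw]
  refine Prod.ext ?_ ?_
  · simp
  · simp only [Prod.snd_sub, Prod.smul_snd, map_sub, map_smul, smul_eq_mul]
    field_simp
    ring

end GraphAlgebra

section Graph

variable {E : Type*} [NormedAddCommGroup E] [NormedSpace ℝ E] [FiniteDimensional ℝ E]
  {M : Type*} [TopologicalSpace M] [ChartedSpace E M]
  {g : TensorField2 𝓘(ℝ, E) M} {ε : ℝ}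

/-- The value of a metric, with both vectors regarded as elements of the model space. -/
def evalMetric {E' : Type*} [NormedAddCommGroup E'] [NormedSpace ℝ E'] {H' : Type*}
    [TopologicalSpace H'] {J : ModelWithCorners ℝ E' H'} {P : Type*} [TopologicalSpace P]
    [ChartedSpace H' P] (G : TensorField2 J P) (p : P) (a b : E') : ℝ :=
  G p a b

theorem metricInChart_eq_evalMetric {E' : Type*} [NormedAddCommGroup E'] [NormedSpace ℝ E']
    {H' : Type*} [TopologicalSpace H'] {J : ModelWithCorners ℝ E' H'}
    {P : Type*} [TopologicalSpace P] [ChartedSpace H' P] (G : TensorField2 J P) (p : P)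
    (y a b : E') :
    metricInChart G p y a b = evalMetric G ((extChartAt J p).symm y)
      (mfderiv 𝓘(ℝ, E') J (extChartAt J p).symm y a)
      (mfderiv 𝓘(ℝ, E') J (extChartAt J p).symm y b) := rfl

theorem christoffel_eq {E' : Type*} [NormedAddCommGroup E'] [NormedSpace ℝ E']
    [FiniteDimensional ℝ E'] {H' : Type*} [TopologicalSpace H'] {J : ModelWithCorners ℝ E' H'}
    {P : Type*} [TopologicalSpace P] [ChartedSpace H' P] (G : TensorField2 J P) (p : P) (a b : E') :
    (christoffel G p a b : E') = sharp (formAt G p : LinearMap.BilinForm ℝ E')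
      (koszul (fderiv ℝ (metricInChart G p) (extChartAt J p p)) a b).toLinearMap := rfl

variable [IsManifold 𝓘(ℝ, E) ∞ M]

theorem metricInChart_productMetric (P : M × ℝ) {q : E × ℝ}
    (hq : q.1 ∈ (extChartAt 𝓘(ℝ, E) P.1).target) (A C : E × ℝ) :
    metricInChart (productMetric g ε) P q A C =
      metricInChart g P.1 q.1 A.1 C.1 + ε * (A.2 * C.2) := by
  have h1 : ((extChartAt (𝓘(ℝ, E).prod 𝓘(ℝ, ℝ)) P).symm : E × ℝ → M × ℝ) =
      fun q ↦ ((extChartAt 𝓘(ℝ, E) P.1).symm q.1, q.2) := by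
    rw [extChartAt_prod, extChartAt_model_space_eq_id]
    rfl
  have h2 : ∀ A : E × ℝ, (mfderiv 𝓘(ℝ, E × ℝ) (𝓘(ℝ, E).prod 𝓘(ℝ, ℝ))
      (extChartAt (𝓘(ℝ, E).prod 𝓘(ℝ, ℝ)) P).symm q A : E × ℝ) =
      (mfderiv 𝓘(ℝ, E) 𝓘(ℝ, E) (extChartAt 𝓘(ℝ, E) P.1).symm q.1 A.1, A.2) := fun A ↦ by
    have hfst : MDifferentiableAt 𝓘(ℝ, E × ℝ) 𝓘(ℝ, E) (Prod.fst : E × ℝ → E) q :=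
      differentiableAt_fst.mdifferentiableAt
    have hsnd : MDifferentiableAt 𝓘(ℝ, E × ℝ) 𝓘(ℝ, ℝ) (Prod.snd : E × ℝ → ℝ) q :=
      differentiableAt_snd.mdifferentiableAt
    have hc := mdifferentiableAt_chart_symm hq
    have h3 := mfderiv_prodMk (hc.comp q hfst) hsnd
    have h4 := mfderiv_comp q hc hfst
    rw [mfderiv_eq_fderiv, fderiv_fst] at h4
    rw [mfderiv_eq_fderiv, fderiv_snd, h4] at h3
    rw [h1]
    exact DFunLike.congr_fun h3 A
  rw [metricInChart_eq_evalMetric, metricInChart_eq_evalMetric, h2, h2, h1]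
  rfl

theorem extChartAt_prod_real_apply (P : M × ℝ) :
    (extChartAt (𝓘(ℝ, E).prod 𝓘(ℝ, ℝ)) P P : E × ℝ) = (extChartAt 𝓘(ℝ, E) P.1 P.1, P.2) := by
  rw [extChartAt_prod, extChartAt_model_space_eq_id]
  rfl

theorem contDiffAt_metricInChart_productMetric (hg : IsSemiRiemannianMetric g) (P : M × ℝ)
    {q : E × ℝ} (hq : q.1 ∈ (extChartAt 𝓘(ℝ, E) P.1).target) :
    ContDiffAt ℝ ∞ (metricInChart (productMetric g ε) P) q := by
  have hopen : IsOpen {q : E × ℝ | q.1 ∈ (extChartAt 𝓘(ℝ, E) P.1).target} :=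
    (isOpen_extChartAt_target P.1).preimage continuous_fst
  refine ContDiffOn.contDiffAt (s := {q : E × ℝ | q.1 ∈ (extChartAt 𝓘(ℝ, E) P.1).target}) ?_
    (hopen.mem_nhds hq)
  refine contDiffOn_clm_apply.2 fun C ↦ contDiffOn_clm_apply.2 fun D ↦ ?_
  have h1 : ∀ y ∈ (extChartAt 𝓘(ℝ, E) P.1).target,
      ContDiffAt ℝ ∞ (fun z ↦ metricInChart g P.1 z C.1 D.1) y := fun y hy ↦
    ((hg.contDiffAt_metricInChart hy).clm_apply contDiffAt_const).clm_apply contDiffAt_const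
  have h2 : ContDiffOn ℝ ∞ (fun q : E × ℝ ↦ metricInChart g P.1 q.1 C.1 D.1 + ε * (C.2 * D.2))
      {q : E × ℝ | q.1 ∈ (extChartAt 𝓘(ℝ, E) P.1).target} := fun y hy ↦
    ((ContDiffAt.comp (g := fun z ↦ metricInChart g P.1 z C.1 D.1) (f := Prod.fst) y
      (h1 y.1 hy) contDiffAt_fst).add contDiffAt_const).contDiffWithinAt
  exact h2.congr fun y hy ↦ metricInChart_productMetric P hy C D

theorem fderiv_metricInChart_productMetric (hg : IsSemiRiemannianMetric g) (P : M × ℝ)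
    (A C D : E × ℝ) :
    fderiv ℝ (metricInChart (productMetric g ε) P) (extChartAt (𝓘(ℝ, E).prod 𝓘(ℝ, ℝ)) P P) A C D =
      fderiv ℝ (metricInChart g P.1) (extChartAt 𝓘(ℝ, E) P.1 P.1) A.1 C.1 D.1 := by
  rw [extChartAt_prod_real_apply]
  set q : E × ℝ := (extChartAt 𝓘(ℝ, E) P.1 P.1, P.2) with hq
  have hopen : IsOpen {q : E × ℝ | q.1 ∈ (extChartAt 𝓘(ℝ, E) P.1).target} :=
    (isOpen_extChartAt_target P.1).preimage continuous_fst
  have hqt : q.1 ∈ (extChartAt 𝓘(ℝ, E) P.1).target := mem_extChartAt_target P.1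
  have hd := (contDiffAt_metricInChart_productMetric (ε := ε) hg P hqt).differentiableAt (by simp)
  have h1 := fderiv_bilin_apply hd (differentiableAt_const C) (differentiableAt_const D) A
  have h2 : (fun z ↦ metricInChart (productMetric g ε) P z C D) =ᶠ[𝓝 q]
      fun z ↦ metricInChart g P.1 z.1 C.1 D.1 + ε * (C.2 * D.2) :=
    Filter.mem_of_superset (hopen.mem_nhds hqt) fun y hy ↦ metricInChart_productMetric P hy C D
  have h3 := fderiv_bilin_apply (E := E) ((hg.contDiffAt_metricInChart hqt).differentiableAt (by simp))
    (differentiableAt_const C.1) (differentiableAt_const D.1) A.1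
  have h4 : HasFDerivAt (fun z : E ↦ metricInChart g P.1 z C.1 D.1) _ q.1 :=
    ((((hg.contDiffAt_metricInChart hqt).differentiableAt (by simp)).clm_apply
      (differentiableAt_const C.1)).clm_apply (differentiableAt_const D.1)).hasFDerivAt
  have h5 : HasFDerivAt (fun z : E × ℝ ↦ metricInChart g P.1 z.1 C.1 D.1 + ε * (C.2 * D.2)) _ q :=
    (HasFDerivAt.comp q h4 hasFDerivAt_fst).add_const _
  rw [h2.fderiv_eq, h5.fderiv, ContinuousLinearMap.comp_apply, ContinuousLinearMap.coe_fst', h3] at h1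
  simp only [fderiv_fun_const, Pi.zero_apply, _root_.zero_apply, map_zero, add_zero] at h1
  exact h1.symm

theorem nondegenerate_productMetric (hg : IsSemiRiemannianMetric g) (hε : ε * ε = 1) (P : M × ℝ) :
    (formAt (productMetric g ε) P : LinearMap.BilinForm ℝ (E × ℝ)).Nondegenerate := by
  have happ : ∀ A C : E × ℝ, (formAt (productMetric g ε) P : LinearMap.BilinForm ℝ (E × ℝ)) A C =
    (g P.1 : E →L[ℝ] E →L[ℝ] ℝ) A.1 C.1 + ε * (A.2 * C.2) := fun _ _ ↦ rfl
  refine nondegenerate_of_symm (fun (A C : E × ℝ) ↦ ?_) fun (A : E × ℝ) hA ↦ ?_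
  · refine (happ A C).trans (Eq.trans ?_ (happ C A).symm)
    exact congrArg₂ (· + ·) (hg.symm _ _ _) (congrArg (ε * ·) (mul_comm _ _))
  · refine Prod.ext ?_ ?_
    · refine (hg.nondegenerate P.1).1 _ fun c ↦ ?_
      have h := (happ A (c, 0)).symm.trans (hA (c, 0))
      rw [mul_zero, mul_zero, add_zero] at h
      exact h
    · have h := (happ A (0, ε)).symm.trans (hA (0, ε))
      have h0 : (g P.1 : E →L[ℝ] E →L[ℝ] ℝ) A.1 (0 : E) = 0 := map_zero _
      have h1 : (0 : ℝ) + ε * (A.2 * ε) = 0 := (congrArg (· + ε * (A.2 * ε)) h0).symm.trans h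
      have h2 : A.2 = 0 := by linear_combination h1 - A.2 * hε
      exact h2

theorem christoffel_productMetric (hg : IsSemiRiemannianMetric g) (hε : ε * ε = 1) (P : M × ℝ)
    (A C : E × ℝ) :
    (christoffel (productMetric g ε) P A C : E × ℝ) = (christoffel g P.1 A.1 C.1, 0) := by
  rw [christoffel_eq]
  refine sharp_eq (nondegenerate_productMetric hg hε P) fun D ↦ ?_
  have h1 : ∀ D : E × ℝ, koszul (fderiv ℝ (metricInChart (productMetric g ε) P)
      (extChartAt (𝓘(ℝ, E).prod 𝓘(ℝ, ℝ)) P P)) A C D =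
      koszul (fderiv ℝ (metricInChart g P.1) (extChartAt 𝓘(ℝ, E) P.1 P.1)) A.1 C.1 D.1 +
        ε * (0 * D.2) := fun D ↦ by
    rw [koszul_apply, fderiv_metricInChart_productMetric hg, fderiv_metricInChart_productMetric hg,
      fderiv_metricInChart_productMetric hg, koszul_apply, zero_mul, mul_zero, add_zero]
  refine Eq.trans ?_ (h1 D).symm
  exact congrArg (· + ε * (0 * (D : E × ℝ).2)) (apply_sharp (hg.nondegenerate P.1) _ _)

variable {u : M → ℝ}

theorem mfderiv_graphMap {x : M} (hu : MDifferentiableAt 𝓘(ℝ, E) 𝓘(ℝ, ℝ) u x) (a : E) :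
    (mfderiv 𝓘(ℝ, E) (𝓘(ℝ, E).prod 𝓘(ℝ, ℝ)) (graphMap u) x a : E × ℝ) =
      (a, differential (E := E) u x a) := by
  have h := mfderiv_prodMk (I := 𝓘(ℝ, E)) (mdifferentiableAt_id (I := 𝓘(ℝ, E)) (x := x)) hu
  rw [mfderiv_id] at h
  exact DFunLike.congr_fun h a

theorem fderiv_fderiv_writtenInExtChartAt_graphMap (hu : ContMDiff 𝓘(ℝ, E) 𝓘(ℝ, ℝ) 2 u) (x : M)
    (a b : E) :
    (fderiv ℝ (fderiv ℝ (writtenInExtChartAt 𝓘(ℝ, E) (𝓘(ℝ, E).prod 𝓘(ℝ, ℝ)) x (graphMap u)))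
      (extChartAt 𝓘(ℝ, E) x x) a b : E × ℝ) =
      (0, fderiv ℝ (fderiv ℝ (u ∘ (extChartAt 𝓘(ℝ, E) x).symm)) (extChartAt 𝓘(ℝ, E) x x) a b) := by
  have : IsManifold 𝓘(ℝ, E) 2 M := IsManifold.of_le (n := ∞) two_le_infty
  set û : E → ℝ := u ∘ (extChartAt 𝓘(ℝ, E) x).symm with hû
  have hus : ContDiffAt ℝ 2 û (extChartAt 𝓘(ℝ, E) x x) :=
    (contMDiffAt_real_iff (mem_extChartAt_source x)).1 (hu x)
  have h1 : (writtenInExtChartAt 𝓘(ℝ, E) (𝓘(ℝ, E).prod 𝓘(ℝ, ℝ)) x (graphMap u) : E → E × ℝ)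
      =ᶠ[𝓝 (extChartAt 𝓘(ℝ, E) x x)] fun y ↦ (y, û y) := by
    filter_upwards [eventually_mem_target x] with y hy
    simp only [writtenInExtChartAt, extChartAt_prod, extChartAt_model_space_eq_id]
    exact Prod.ext ((extChartAt 𝓘(ℝ, E) x).right_inv hy) rfl
  have h2 : fderiv ℝ (fun y ↦ (y, û y)) =ᶠ[𝓝 (extChartAt 𝓘(ℝ, E) x x)]
      fun y ↦ ContinuousLinearMap.inl ℝ E ℝ + (ContinuousLinearMap.inr ℝ E ℝ).comp (fderiv ℝ û y) := by
    filter_upwards [hus.eventually (by simp)] with y hy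
    have hd := (hy.differentiableAt (by norm_num)).hasFDerivAt
    have hp : HasFDerivAt (fun y ↦ (y, û y)) _ y := (hasFDerivAt_id y).prodMk hd
    rw [hp.fderiv]
    ext <;> simp
  have hd2 : HasFDerivAt (fderiv ℝ û) _ (extChartAt 𝓘(ℝ, E) x x) :=
    ((hus.fderiv_right (m := 1) (by norm_num)).differentiableAt (by norm_num)).hasFDerivAt
  have h3 := ((hasFDerivAt_const (ContinuousLinearMap.inr ℝ E ℝ)
    (extChartAt 𝓘(ℝ, E) x x)).clm_comp hd2).const_add (ContinuousLinearMap.inl ℝ E ℝ)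
  have h4 := (h1.fderiv (𝕜 := ℝ)).trans h2
  refine (DFunLike.congr_fun (DFunLike.congr_fun (h4.fderiv_eq.trans h3.fderiv) a) b).trans ?_
  simp

theorem inducedForm_graphMap_apply {x : M} (hu : MDifferentiableAt 𝓘(ℝ, E) 𝓘(ℝ, ℝ) u x)
    (a b : TangentSpace 𝓘(ℝ, E) x) :
    inducedForm 𝓘(ℝ, E) (productMetric g ε) (graphMap u) x a b =
      formAt g x a b + ε * (differential u x a * differential u x b) :=
  congrArg₂ (fun X Y : E × ℝ ↦
    (productMetric g ε (graphMap u x) : E × ℝ →L[ℝ] E × ℝ →L[ℝ] ℝ) X Y)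
    (mfderiv_graphMap hu a) (mfderiv_graphMap hu b)

theorem differential_gradient (hg : IsSemiRiemannianMetric g) (u : M → ℝ) (x : M) :
    differential u x (sharp (formAt g x) (differential u x)) = gradNormSq g u x :=
  (apply_gradient hg u x _).symm

theorem nondegenerate_inducedForm_graphMap_iff (hg : IsSemiRiemannianMetric g) (hε : ε * ε = 1)
    {x : M} (hu : MDifferentiableAt 𝓘(ℝ, E) 𝓘(ℝ, ℝ) u x) :
    (inducedForm 𝓘(ℝ, E) (productMetric g ε) (graphMap u) x).Nondegenerate ↔
      ε + gradNormSq g u x ≠ 0 := by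
  rw [nondegenerate_add_rankOne_iff (hg.nondegenerate x) (hg.symm x) hε
    (inducedForm_graphMap_apply hu), differential_gradient hg]

theorem normalPart_graphMap (hg : IsSemiRiemannianMetric g) (hε : ε * ε = 1)
    {x : M} (hu : MDifferentiableAt 𝓘(ℝ, E) 𝓘(ℝ, ℝ) u x) (h0 : ε + gradNormSq g u x ≠ 0)
    (Z : E × ℝ) :
    (normalPart 𝓘(ℝ, E) (productMetric g ε) (graphMap u) x Z : E × ℝ) =
      ((differential (E := E) u x Z.1 - Z.2) / (ε + gradNormSq g u x)) •
        ((gradient g u x, -ε) : E × ℝ) := by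
  have h := sub_sharp_graph (hg.nondegenerate x) (hg.symm x) hε
    (γ := inducedForm 𝓘(ℝ, E) (productMetric g ε) (graphMap u) x)
    (inducedForm_graphMap_apply hu) (by rwa [differential_gradient hg]) Z.1 Z.2
    (k := (formAt (productMetric g ε) (graphMap u x) Z).comp
      (mfderiv 𝓘(ℝ, E) (𝓘(ℝ, E).prod 𝓘(ℝ, ℝ)) (graphMap u) x).toLinearMap) fun a ↦
        congrArg (fun X : E × ℝ ↦
          (productMetric g ε (graphMap u x) : E × ℝ →L[ℝ] E × ℝ →L[ℝ] ℝ) Z X)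
          (mfderiv_graphMap hu a)
  rw [differential_gradient hg] at h
  exact Eq.trans (congrArg (fun X : E × ℝ ↦ Z - X) (mfderiv_graphMap hu _)) h

theorem secondFundForm_graphMap (hg : IsSemiRiemannianMetric g) (hε : ε * ε = 1)
    (hu : ContMDiff 𝓘(ℝ, E) 𝓘(ℝ, ℝ) 2 u) {x : M} (h0 : ε + gradNormSq g u x ≠ 0)
    (a b : TangentSpace 𝓘(ℝ, E) x) :
    (secondFundForm 𝓘(ℝ, E) (productMetric g ε) (graphMap u) x a b : E × ℝ) =
      (-hessian g u x a b / (ε + gradNormSq g u x)) • ((gradient g u x, -ε) : E × ℝ) := by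
  have hd := hu.mdifferentiable (by norm_num) x
  have h1 : (christoffel (productMetric g ε) (graphMap u x)
      (mfderiv 𝓘(ℝ, E) (𝓘(ℝ, E).prod 𝓘(ℝ, ℝ)) (graphMap u) x a)
      (mfderiv 𝓘(ℝ, E) (𝓘(ℝ, E).prod 𝓘(ℝ, ℝ)) (graphMap u) x b) : E × ℝ) =
      (christoffel g x a b, 0) :=
    (congrArg₂ (fun X Y : E × ℝ ↦ (christoffel (productMetric g ε) (graphMap u x) X Y : E × ℝ))
      (mfderiv_graphMap hd a) (mfderiv_graphMap hd b)).trans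
      (christoffel_productMetric hg hε _ _ _)
  have h2 := congrArg₂ (fun X Y : E × ℝ ↦ X + Y)
    (fderiv_fderiv_writtenInExtChartAt_graphMap hu x a b) h1
  refine (congrArg (fun Z : E × ℝ ↦
    (normalPart 𝓘(ℝ, E) (productMetric g ε) (graphMap u) x Z : E × ℝ)) h2).trans ?_
  refine (normalPart_graphMap hg hε hd h0 _).trans ?_
  refine congrArg (fun c : ℝ ↦ (c / (ε + gradNormSq g u x)) •
    ((gradient g u x, -ε) : E × ℝ)) ?_
  have h3 : hessian g u x a b =
      fderiv ℝ (fderiv ℝ (u ∘ (extChartAt 𝓘(ℝ, E) x).symm)) (extChartAt 𝓘(ℝ, E) x x) a b -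
      differential u x (christoffel g x a b) := by
    refine (localHess_apply (E := E) (metricInChart g x) (u ∘ (extChartAt 𝓘(ℝ, E) x).symm)
      (extChartAt 𝓘(ℝ, E) x x) a b).trans ?_
    refine congrArg (_ - ·) (Eq.trans ?_ (mfderiv_apply_eq_fderiv hd _).symm)
    exact congrArg (fun B : LinearMap.BilinForm ℝ E ↦
      fderiv ℝ (u ∘ (extChartAt 𝓘(ℝ, E) x).symm) (extChartAt 𝓘(ℝ, E) x x) (sharp B
        (koszul (fderiv ℝ (metricInChart g x) (extChartAt 𝓘(ℝ, E) x x)) a b).toLinearMap))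
      (toBilinForm_metricInChart_self x)
  have h4 : ∀ (L : E →ₗ[ℝ] ℝ) (Γ : E) (D : ℝ),
      L ((0, D) + (Γ, 0) : E × ℝ).1 - ((0, D) + (Γ, 0) : E × ℝ).2 = -(D - L Γ) := by
    intro L Γ D; simp
  exact (h4 _ _ _).trans (congrArg Neg.neg h3).symm

/-- The soliton equation for a graph, at a point where the graph is nondegenerate. -/
theorem meanCurvatureVector_graphMap_eq_iff (hg : IsSemiRiemannianMetric g) (hε : ε * ε = 1)
    (hu : ContMDiff 𝓘(ℝ, E) 𝓘(ℝ, ℝ) 2 u) {x : M} (h0 : ε + gradNormSq g u x ≠ 0) :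
    meanCurvatureVector 𝓘(ℝ, E) (productMetric g ε) (graphMap u) x =
      normalPart 𝓘(ℝ, E) (productMetric g ε) (graphMap u) x
        (verticalField 𝓘(ℝ, E) (graphMap u x)) ↔
      laplacian g u x - hessian g u x (gradient g u x) (gradient g u x) / (ε + gradNormSq g u x) =
        1 := by
  have hd := hu.mdifferentiable (by norm_num) x
  set W := ε + gradNormSq g u x with hW
  set ν : E × ℝ := (gradient g u x, -ε) with hν
  set T := metricTrace (inducedForm 𝓘(ℝ, E) (productMetric g ε) (graphMap u) x)
    (fun a b ↦ hessian g u x a b) with hT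
  have hν0 : ν ≠ 0 := fun h ↦ by
    have h2 : -ε = 0 := congrArg Prod.snd h
    rw [neg_eq_zero.1 h2] at hε
    norm_num at hε
  have h1 : (meanCurvatureVector 𝓘(ℝ, E) (productMetric g ε) (graphMap u) x : E × ℝ) =
      (-T / W) • ν := by
    have e : (meanCurvatureVector 𝓘(ℝ, E) (productMetric g ε) (graphMap u) x : E × ℝ) =
      ∑ i, (secondFundForm 𝓘(ℝ, E) (productMetric g ε) (graphMap u) x
        (sharp (inducedForm 𝓘(ℝ, E) (productMetric g ε) (graphMap u) x)
          ((Module.finBasis ℝ (TangentSpace 𝓘(ℝ, E) x)).coord i))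
        (Module.finBasis ℝ (TangentSpace 𝓘(ℝ, E) x) i) : E × ℝ) := rfl
    refine e.trans ((Finset.sum_congr rfl fun i _ ↦
      secondFundForm_graphMap hg hε hu h0 _ _).trans ?_)
    have hsum : ∀ c : Fin (Module.finrank ℝ (TangentSpace 𝓘(ℝ, E) x)) → ℝ,
        ∑ i, (-c i / W) • ν = (-(∑ i, c i) / W) • ν := fun c ↦ by
      rw [← Finset.sum_smul, ← Finset.sum_div, Finset.sum_neg_distrib]
    exact hsum _
  have h2 : (normalPart 𝓘(ℝ, E) (productMetric g ε) (graphMap u) x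
        (verticalField 𝓘(ℝ, E) (graphMap u x)) : E × ℝ) = (-1 / W) • ν := by
    refine (normalPart_graphMap hg hε hd h0 ((0, 1) : E × ℝ)).trans ?_
    exact congrArg (fun c : ℝ ↦ (c / W) • ν)
      ((congrArg (· - (1 : ℝ)) (map_zero (differential (E := E) u x))).trans (zero_sub 1))
  have h3 : T = laplacian g u x - hessian g u x (gradient g u x) (gradient g u x) / W := by
    have := metricTrace_add_rankOne (hg.nondegenerate x) (hg.symm x) hε
      (γ := inducedForm 𝓘(ℝ, E) (productMetric g ε) (graphMap u) x)
      (inducedForm_graphMap_apply hd) (by rwa [differential_gradient hg]) (hessian g u x)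
    rw [differential_gradient hg] at this
    exact this
  rw [← h3]
  constructor
  · intro h
    have h4 : (-T / W) • ν = (-1 / W) • ν := h1.symm.trans (Eq.trans h h2)
    have h5 := smul_left_injective ℝ hν0 h4
    field_simp at h5
    linarith
  · intro h
    rw [h] at h1
    exact h1.trans h2.symm

theorem isTranslatingSoliton_graphMap_iff (hg : IsSemiRiemannianMetric g) (hε : ε * ε = 1)
    (hu : ContMDiff 𝓘(ℝ, E) 𝓘(ℝ, ℝ) 2 u) :
    IsTranslatingSoliton 𝓘(ℝ, E) g ε (graphMap u) ↔
      (∀ x, ε + gradNormSq g u x ≠ 0) ∧ ∀ x, laplacian g u x -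
        hessian g u x (gradient g u x) (gradient g u x) / (ε + gradNormSq g u x) = 1 := by
  have hd := fun x ↦ hu.mdifferentiable (by norm_num) x
  have hF : ContMDiff 𝓘(ℝ, E) (𝓘(ℝ, E).prod 𝓘(ℝ, ℝ)) 2 (graphMap u) := contMDiff_id.prodMk hu
  simp only [IsTranslatingSoliton, hF, true_and,
    fun x ↦ nondegenerate_inducedForm_graphMap_iff hg hε (hd x)]
  exact and_congr_right fun h ↦
    forall_congr' fun x ↦ meanCurvatureVector_graphMap_eq_iff hg hε hu (h x)

end Graph

section RealLine

theorem exists_antiderivative {J : Set ℝ} (hJ : IsOpen J) (hJc : J.OrdConnected) {r : ℝ → ℝ}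
    (hr : ContinuousOn r J) : ∃ v : ℝ → ℝ, ∀ s ∈ J, HasDerivAt v (r s) s := by
  rcases J.eq_empty_or_nonempty with rfl | ⟨s₀, hs₀⟩
  · exact ⟨0, by simp⟩
  · refine ⟨fun s ↦ ∫ t in s₀..s, r t, fun s hs ↦ ?_⟩
    exact intervalIntegral.integral_hasDerivAt_right
      ((hr.mono (hJc.uIcc_subset hs₀ hs)).intervalIntegrable)
      (hr.stronglyMeasurableAtFilter hJ s hs) (hr.continuousAt (hJ.mem_nhds hs))

/-- A solution of a linear homogeneous equation vanishes nowhere, or everywhere. -/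
theorem ne_zero_of_linear_ode {J : Set ℝ} (hJ : IsOpen J) (hJc : J.OrdConnected) {k Q : ℝ → ℝ}
    (hk : ContinuousOn k J) (hQ : ∀ s ∈ J, HasDerivAt Q (k s * Q s) s) {s₁ : ℝ} (hs₁ : s₁ ∈ J)
    (h₁ : Q s₁ ≠ 0) : ∀ s ∈ J, Q s ≠ 0 := by
  obtain ⟨K, hK⟩ := exists_antiderivative hJ hJc hk
  have hd : ∀ s ∈ J, HasDerivAt (fun s ↦ Q s * Real.exp (-K s)) 0 s := fun s hs ↦ by
    refine ((hQ s hs).mul (hK s hs).neg.exp).congr_deriv ?_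
    ring
  intro s hs h0
  have h := hJ.is_const_of_deriv_eq_zero hJc.isPreconnected
    (fun s hs ↦ (hd s hs).differentiableAt.differentiableWithinAt) (fun s hs ↦ (hd s hs).deriv)
    hs₁ hs
  rw [h0, zero_mul] at h
  exact h₁ ((mul_eq_zero.1 h).resolve_right (Real.exp_pos _).ne')

theorem contDiffOn_two_of_hasDerivAt {J : Set ℝ} (hJ : IsOpen J) {r v : ℝ → ℝ}
    (hr : ContDiffOn ℝ 1 r J) (hv : ∀ s ∈ J, HasDerivAt v (r s) s) : ContDiffOn ℝ 2 v J := by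
  have h := contDiffOn_succ_iff_deriv_of_isOpen (n := 1) (𝕜 := ℝ) (f := v) hJ
  rw [one_add_one_eq_two] at h
  exact h.2 ⟨fun s hs ↦ (hv s hs).differentiableAt.differentiableWithinAt, by simp,
    hr.congr fun s hs ↦ (hv s hs).deriv⟩

theorem image_mem_nhds_of_hasDerivAt {J : Set ℝ} (hJ : IsOpen J) {v : ℝ → ℝ}
    (hv : ContDiffOn ℝ 2 v J) {s : ℝ} (hs : s ∈ J) (h0 : deriv v s ≠ 0) : v '' J ∈ 𝓝 (v s) := by
  have h := (hv.contDiffAt (hJ.mem_nhds hs)).hasStrictDerivAt (by norm_num)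
  rw [← h.map_nhds_eq h0]
  exact image_mem_map (hJ.mem_nhds hs)

theorem injOn_of_hasDerivAt_pos {J : Set ℝ} (hJc : J.OrdConnected) {r v : ℝ → ℝ}
    (hr : ∀ s ∈ J, 0 < r s) (hv : ∀ s ∈ J, HasDerivAt v (r s) s) : Set.InjOn v J := by
  refine (strictMonoOn_of_deriv_pos hJc.convex
    (fun s hs ↦ (hv s hs).continuousAt.continuousWithinAt) fun s hs ↦ ?_).injOn
  rw [(hv s (interior_subset hs)).deriv]
  exact hr s (interior_subset hs)

end RealLine

section Submersion

variable {E : Type*} [NormedAddCommGroup E] [NormedSpace ℝ E]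
  {M : Type*} [TopologicalSpace M] [ChartedSpace E M] [IsManifold 𝓘(ℝ, E) ∞ M]

/-- A function with nonzero differential has local right inverses. -/
theorem exists_local_section {n : WithTop ℕ∞} (hn0 : n ≠ 0) (hn : n ≤ ∞) {w : M → ℝ} {x : M}
    (hw : ContMDiffAt 𝓘(ℝ, E) 𝓘(ℝ, ℝ) n w x) (h0 : differential (E := E) w x ≠ 0) :
    ∃ c : ℝ → M, ContMDiffAt 𝓘(ℝ, ℝ) 𝓘(ℝ, E) n c (w x) ∧ c (w x) = x ∧
      ∀ᶠ t in 𝓝 (w x), w (c t) = t := by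
  have : IsManifold 𝓘(ℝ, E) n M := IsManifold.of_le (n := ∞) hn
  obtain ⟨a, ha⟩ : ∃ a : E, differential (E := E) w x a ≠ 0 := by
    by_contra! h
    exact h0 (LinearMap.ext h)
  set y := extChartAt 𝓘(ℝ, E) x x with hy
  set W : E → ℝ := w ∘ (extChartAt 𝓘(ℝ, E) x).symm with hW
  have hyx : (extChartAt 𝓘(ℝ, E) x).symm y = x :=
    (extChartAt 𝓘(ℝ, E) x).left_inv (mem_extChartAt_source x)
  have hWs : ContDiffAt ℝ n W y := (contMDiffAt_real_iff (mem_extChartAt_source x)).1 hw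
  have hda : fderiv ℝ W y a ≠ 0 := by
    have h1 : differential (E := E) w x a = _ :=
      mfderiv_apply_eq_fderiv (hw.mdifferentiableAt hn0) a
    exact h1 ▸ ha
  have hline : ContDiffAt ℝ n (fun t : ℝ ↦ y + t • a) 0 :=
    contDiffAt_const.add (contDiffAt_id.smul contDiffAt_const)
  have hline0 : y + (0 : ℝ) • a = y := by simp
  have hτ : ContDiffAt ℝ n (fun t : ℝ ↦ W (y + t • a)) 0 :=
    ContDiffAt.comp (g := W) (0 : ℝ) (by rwa [hline0]) hline
  have hτ0 : W (y + (0 : ℝ) • a) = w x := by rw [hline0, hW, Function.comp_apply, hyx]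
  have hτ' : HasDerivAt (fun t : ℝ ↦ W (y + t • a)) (fderiv ℝ W y a) 0 := by
    have h1 : HasDerivAt (fun t : ℝ ↦ y + t • a) a 0 := by
      simpa using ((hasDerivAt_id (0 : ℝ)).smul_const a).const_add y
    have h2 : HasFDerivAt W (fderiv ℝ W y) (y + (0 : ℝ) • a) := by
      rw [hline0]; exact (hWs.differentiableAt hn0).hasFDerivAt
    exact h2.comp_hasDerivAt (0 : ℝ) h1
  let e : ℝ ≃L[ℝ] ℝ := ContinuousLinearEquiv.unitsEquivAut ℝ (Units.mk0 _ hda)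
  have hτe : HasFDerivAt (fun t : ℝ ↦ W (y + t • a)) (e : ℝ →L[ℝ] ℝ) 0 := by
    have he : (e : ℝ →L[ℝ] ℝ) = ContinuousLinearMap.toSpanSingleton ℝ (fderiv ℝ W y a) := by
      ext
      simp [e]
    rw [he]
    exact hτ'.hasFDerivAt
  have hσ := hτ.to_localInverse hτe hn0
  have hσ0 := hτ.localInverse_apply_image hτe hn0
  have hσr := (hτ.hasStrictFDerivAt' hτe hn0).eventually_right_inverse
  set σ : ℝ → ℝ := hτ.localInverse hτe hn0 with hσdef
  simp only [hτ0] at hσ hσ0 hσr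
  refine ⟨fun t ↦ (extChartAt 𝓘(ℝ, E) x).symm (y + σ t • a), ?_, ?_, hσr⟩
  · refine ContMDiffAt.comp (I' := 𝓘(ℝ, E)) (w x) (g := (extChartAt 𝓘(ℝ, E) x).symm)
      (f := fun t ↦ y + σ t • a) ?_ ?_
    · rw [hσ0, hline0]
      exact (contMDiffAt_chart_symm (mem_extChartAt_target x)).of_le hn
    · exact (contDiffAt_const.add (hσ.smul contDiffAt_const)).contMDiffAt
  · simp only [hσ0, hline0, hyx]

/-- If `f ∘ w` is `C^m` for a function `w` with nonzero differential, then `f` is `C^m`. -/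
theorem contDiffAt_of_comp {n m : WithTop ℕ∞} (hn0 : n ≠ 0) (hn : n ≤ ∞) (hmn : m ≤ n)
    {w : M → ℝ} {x : M} (hw : ContMDiffAt 𝓘(ℝ, E) 𝓘(ℝ, ℝ) n w x)
    (h0 : differential (E := E) w x ≠ 0) {f : ℝ → ℝ}
    (hf : ContMDiffAt 𝓘(ℝ, E) 𝓘(ℝ, ℝ) m (f ∘ w) x) : ContDiffAt ℝ m f (w x) := by
  obtain ⟨c, hc, hcx, hwc⟩ := exists_local_section hn0 hn hw h0
  rw [← contMDiffAt_iff_contDiffAt]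
  have h1 : ContMDiffAt 𝓘(ℝ, ℝ) 𝓘(ℝ, ℝ) m ((f ∘ w) ∘ c) (w x) :=
    ContMDiffAt.comp (I' := 𝓘(ℝ, E)) (w x) (by rwa [hcx]) (hc.of_le hmn)
  refine h1.congr_of_eventuallyEq (hwc.mono fun t ht ↦ ?_)
  simp only [Function.comp_apply, ht]

end Submersion

section Geometry

variable {E : Type*} [NormedAddCommGroup E] [NormedSpace ℝ E] [FiniteDimensional ℝ E]
  {M : Type*} [TopologicalSpace M] [ChartedSpace E M] [IsManifold 𝓘(ℝ, E) ∞ M]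
  {g : TensorField2 𝓘(ℝ, E) M}

theorem gradient_smul_isometry (hg : IsSemiRiemannianMetric g) {S : Type*} [SMul S M]
    (hS : ActsByIsometries S g) {q : M → ℝ} (hq : MDifferentiable 𝓘(ℝ, E) 𝓘(ℝ, ℝ) q) {σ : S}
    (hσ : MDifferentiable 𝓘(ℝ, E) 𝓘(ℝ, E) fun x : M ↦ σ • x) (hqσ : ∀ x : M, q (σ • x) = q x)
    (x : M) :
    gradient g q (σ • x) =
      mfderiv 𝓘(ℝ, E) 𝓘(ℝ, E) (fun y : M ↦ σ • y) x (gradient g q x) := by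
  let L : E →ₗ[ℝ] E := (mfderiv 𝓘(ℝ, E) 𝓘(ℝ, E) (fun y : M ↦ σ • y) x).toLinearMap
  have hinj : Function.Injective L := by
    rw [← LinearMap.ker_eq_bot, LinearMap.ker_eq_bot']
    intro a ha
    refine (hg.nondegenerate x).1 a fun b ↦ ?_
    let G : E →L[ℝ] E →L[ℝ] ℝ := g (σ • x)
    have h1 : G (L a) (L b) = g x a b := hS σ x a b
    rw [ha, map_zero, _root_.zero_apply] at h1
    exact h1.symm
  let A : E ≃ₗ[ℝ] E := LinearEquiv.ofInjectiveEndo L hinj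
  have hd : ∀ a : E, differential (E := E) q x a = differential (E := E) q (σ • x) (A a) := fun a ↦ by
    have h1 := mfderiv_comp x (hq (σ • x)) (hσ x)
    have h2 : q ∘ (fun y : M ↦ σ • y) = q := funext hqσ
    rw [h2] at h1
    exact DFunLike.congr_fun h1 a
  let B : LinearMap.BilinForm ℝ E := formAt g (σ • x)
  let B' : LinearMap.BilinForm ℝ E := formAt g x
  exact (sharp_comp_equiv (B := B) (B' := B')
    (hg.nondegenerate _) (hg.symm _) A (fun a b ↦ (hS σ x a b).symm)
    (ℓ := differential (E := E) q (σ • x)) (ℓ' := differential (E := E) q x) hd).symm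

theorem gradNormSq_smul_isometry (hg : IsSemiRiemannianMetric g) {S : Type*} [SMul S M]
    (hS : ActsByIsometries S g) {q : M → ℝ} (hq : MDifferentiable 𝓘(ℝ, E) 𝓘(ℝ, ℝ) q) {σ : S}
    (hσ : MDifferentiable 𝓘(ℝ, E) 𝓘(ℝ, E) fun x : M ↦ σ • x) (hqσ : ∀ x : M, q (σ • x) = q x)
    (x : M) : gradNormSq g q (σ • x) = gradNormSq g q x := by
  rw [gradNormSq, gradient_smul_isometry hg hS hq hσ hqσ, hS]
  rfl

theorem differential_comp {w : M → ℝ} {x : M} (hw : MDifferentiableAt 𝓘(ℝ, E) 𝓘(ℝ, ℝ) w x)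
    {f : ℝ → ℝ} {f' : ℝ} (hf : HasDerivAt f f' (w x)) :
    differential (E := E) (f ∘ w) x = f' • differential (E := E) w x := by
  have h1 := mfderiv_comp x (hf.differentiableAt.mdifferentiableAt) hw
  rw [mfderiv_eq_fderiv, hf.hasFDerivAt.fderiv] at h1
  ext a
  refine (DFunLike.congr_fun h1 a).trans ?_
  exact mul_comm (differential (E := E) w x a) f'

theorem gradient_comp {w : M → ℝ} {x : M} (hw : MDifferentiableAt 𝓘(ℝ, E) 𝓘(ℝ, ℝ) w x)
    {f : ℝ → ℝ} {f' : ℝ} (hf : HasDerivAt f f' (w x)) :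
    gradient g (f ∘ w) x = f' • gradient g w x := by
  change sharpₗ (formAt g x) (differential (f ∘ w) x) = f' • sharpₗ (formAt g x) (differential w x)
  rw [differential_comp hw hf, map_smul]

theorem gradNormSq_comp {w : M → ℝ} {x : M} (hw : MDifferentiableAt 𝓘(ℝ, E) 𝓘(ℝ, ℝ) w x)
    {f : ℝ → ℝ} {f' : ℝ} (hf : HasDerivAt f f' (w x)) :
    gradNormSq g (f ∘ w) x = f' ^ 2 * gradNormSq g w x := by
  rw [gradNormSq, gradNormSq, gradient_comp hw hf, map_smul, map_smul, _root_.smul_apply,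
    smul_eq_mul, smul_eq_mul, sq, mul_assoc]

theorem laplacian_comp (hg : IsSemiRiemannianMetric g) {w : M → ℝ}
    (hw : ContMDiff 𝓘(ℝ, E) 𝓘(ℝ, ℝ) 2 w) {x : M} {f : ℝ → ℝ} (hf : ContDiffAt ℝ 2 f (w x)) :
    laplacian g (f ∘ w) x =
      deriv (deriv f) (w x) * gradNormSq g w x + deriv f (w x) * laplacian g w x := by
  have h1 : gradNormSq g w x = ∑ i, differential w x
      (sharp (formAt g x) ((Module.finBasis ℝ (TangentSpace 𝓘(ℝ, E) x)).coord i)) *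
        differential w x (Module.finBasis ℝ (TangentSpace 𝓘(ℝ, E) x) i) := by
    have h2 : ∀ i, differential w x
        (sharp (formAt g x) ((Module.finBasis ℝ (TangentSpace 𝓘(ℝ, E) x)).coord i)) =
        (Module.finBasis ℝ (TangentSpace 𝓘(ℝ, E) x)).repr (gradient g w x) i := fun i ↦ by
      rw [← apply_gradient hg, hg.symm]
      exact apply_sharp (hg.nondegenerate x) _ _
    simp only [h2]
    have h3 := congrArg (differential w x)
      ((Module.finBasis ℝ (TangentSpace 𝓘(ℝ, E) x)).sum_repr (gradient g w x))
    simp only [map_sum, map_smul, smul_eq_mul] at h3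
    rw [h3]
    exact apply_gradient hg w x _
  rw [h1, laplacian, laplacian, metricTrace, metricTrace, Finset.mul_sum, Finset.mul_sum,
    ← Finset.sum_add_distrib]
  exact Finset.sum_congr rfl fun i _ ↦ hessian_comp g hw hf _ _

/-- The soliton equation for `f ∘ w`, where the gradient of `w` has constant length `±1`. -/
theorem soliton_equation_comp_iff (hg : IsSemiRiemannianMetric g) {ε εt : ℝ} (hε : ε * ε = 1)
    (hεt : εt * εt = 1) {w : M → ℝ} (hw : ContMDiff 𝓘(ℝ, E) 𝓘(ℝ, ℝ) 2 w)
    (hwe : ∀ x, gradNormSq g w x = εt) {x : M} {f : ℝ → ℝ} (hf : ContDiffAt ℝ 2 f (w x))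
    (h0 : ε + gradNormSq g (f ∘ w) x ≠ 0) :
    laplacian g (f ∘ w) x - hessian g (f ∘ w) x (gradient g (f ∘ w) x) (gradient g (f ∘ w) x) /
      (ε + gradNormSq g (f ∘ w) x) = 1 ↔
    deriv (deriv f) (w x) =
      (εt + ε * deriv f (w x) ^ 2) * (1 - deriv f (w x) * laplacian g w x) := by
  have hd := hw.mdifferentiable (by norm_num) x
  have hf' : HasDerivAt f (deriv f (w x)) (w x) :=
    (hf.differentiableAt (by norm_num)).hasDerivAt
  have hdg : differential w x (gradient g w x) = εt :=
    (apply_gradient hg w x _).symm.trans (hwe x)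
  have hH : hessian g (f ∘ w) x (gradient g (f ∘ w) x) (gradient g (f ∘ w) x) =
      deriv f (w x) ^ 2 * deriv (deriv f) (w x) := by
    rw [hessian_comp g hw hf, gradient_comp hd hf', map_smul, map_smul,
      hessian_apply_gradient hg hw hwe, hdg, smul_eq_mul]
    linear_combination deriv f (w x) ^ 2 * deriv (deriv f) (w x) * hεt
  rw [gradNormSq_comp hd hf', hwe] at h0
  rw [hH, laplacian_comp hg hw hf, gradNormSq_comp hd hf', hwe]
  set p := deriv f (w x)
  set q := deriv (deriv f) (w x)
  set l := laplacian g w x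
  rw [sub_eq_iff_eq_add, ← sub_eq_iff_eq_add', eq_div_iff h0]
  have hsq : εt * ε ≠ 0 := by
    refine mul_ne_zero ?_ ?_
    · rintro rfl
      norm_num at hεt
    · rintro rfl
      norm_num at hε
  constructor
  · intro h
    refine mul_left_cancel₀ hsq ?_
    linear_combination h - q * p ^ 2 * hεt - (εt * p ^ 2 - εt * p ^ 3 * l) * hε -
      (ε - ε * p * l) * hεt
  · intro h
    linear_combination εt * ε * h + q * p ^ 2 * hεt + (εt * p ^ 2 - εt * p ^ 3 * l) * hε +
      (ε - ε * p * l) * hεt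

end Geometry

theorem exists_sign_mul_pos {X : Type*} [TopologicalSpace X] [PreconnectedSpace X] {G : X → ℝ}
    (hG : Continuous G) (h0 : ∀ x, G x ≠ 0) :
    ∃ e : ℝ, (e = 1 ∨ e = -1) ∧ ∀ x, 0 < e * G x := by
  by_cases h : ∃ x, G x ≤ 0
  · refine ⟨-1, Or.inr rfl, fun x ↦ ?_⟩
    by_contra! hx
    obtain ⟨y, hy⟩ := mem_range_of_exists_le_of_exists_ge hG h ⟨x, by linarith⟩
    exact h0 y hy
  · push Not at h
    exact ⟨1, Or.inl rfl, fun x ↦ by simpa using h x⟩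

section InvariantSolitons

variable {E : Type*} [NormedAddCommGroup E] [NormedSpace ℝ E] [FiniteDimensional ℝ E]
  {M : Type*} [TopologicalSpace M] [ChartedSpace E M] [IsManifold 𝓘(ℝ, E) ∞ M]
  {g : TensorField2 𝓘(ℝ, E) M} {π : M → ℝ} {J : Set ℝ} {e : ℝ} {r v : ℝ → ℝ}

theorem gradNormSq_ne_zero (hg : IsSemiRiemannianMetric g) {x : M}
    (h0 : differential (E := E) π x ≠ 0) (hl : ¬ IsLightlike g x (gradient g π x)) :
    gradNormSq g π x ≠ 0 := fun h ↦ by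
  refine hl ⟨fun h1 ↦ h0 ?_, h⟩
  ext a
  rw [← apply_gradient hg, h1]
  simp

theorem contDiffAt_speed (hg : IsSemiRiemannianMetric g) (hπ : ContMDiff 𝓘(ℝ, E) 𝓘(ℝ, ℝ) 2 π)
    {x : M} (h0 : differential (E := E) π x ≠ 0) (hG : ∀ x, 0 < e * gradNormSq g π x)
    (hr : ∀ x, r (π x) = (√(e * gradNormSq g π x))⁻¹) : ContDiffAt ℝ 1 r (π x) := by
  refine contDiffAt_of_comp (n := 2) (by norm_num) two_le_infty (by norm_num) (hπ x) h0 ?_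
  have h1 : ContDiffAt ℝ 1 (fun t : ℝ ↦ (√(e * t))⁻¹) (gradNormSq g π x) :=
    ((contDiffAt_const.mul contDiffAt_id).sqrt (hG x).ne').inv (Real.sqrt_pos.2 (hG x)).ne'
  refine (ContMDiffAt.comp x h1.contMDiffAt (contMDiff_gradNormSq hg hπ x)).congr_of_eventuallyEq
    (Eventually.of_forall fun y ↦ hr y)

theorem unitNormal_eq_gradient_comp (hπ : MDifferentiable 𝓘(ℝ, E) 𝓘(ℝ, ℝ) π) (he : e * e = 1)
    (hG : ∀ x, 0 < e * gradNormSq g π x)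
    (hv : ∀ x, HasDerivAt v (√(e * gradNormSq g π x))⁻¹ (π x)) :
    unitNormal g π = gradient g (v ∘ π) := by
  funext x
  have habs : |gradNormSq g π x| = e * gradNormSq g π x := by
    rw [← abs_of_pos (hG x), abs_mul, abs_eq_abs.2 (mul_self_eq_one_iff.1 he), abs_one, one_mul]
  rw [unitNormal, gradient_comp (hπ x) (hv x), habs]

theorem gradNormSq_comp_eq_sign (hπ : MDifferentiable 𝓘(ℝ, E) 𝓘(ℝ, ℝ) π) (he : e * e = 1)
    (hG : ∀ x, 0 < e * gradNormSq g π x)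
    (hv : ∀ x, HasDerivAt v (√(e * gradNormSq g π x))⁻¹ (π x)) (x : M) :
    gradNormSq g (v ∘ π) x = e := by
  rw [gradNormSq_comp (hπ x) (hv x), inv_pow, Real.sq_sqrt (hG x).le, inv_mul_eq_div,
    div_eq_iff (hG x).ne', ← mul_assoc, he, one_mul]

/-- The graph of `f ∘ v` over the level sets of `π` is a soliton if and only if `f` solves the
ordinary differential equation of the profile. -/
theorem isTranslatingSoliton_comp_iff (hg : IsSemiRiemannianMetric g) {ε : ℝ} (hε : ε * ε = 1)
    (he : e * e = 1) (hJ : IsOpen J) (hJc : J.OrdConnected) (hπJ : Set.range π = J)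
    (hv : ∀ s ∈ J, HasDerivAt v (r s) s) (hr : ContinuousOn r J)
    (hw : ContMDiff 𝓘(ℝ, E) 𝓘(ℝ, ℝ) 2 (v ∘ π)) (hwe : ∀ x, gradNormSq g (v ∘ π) x = e)
    {h : ℝ → ℝ} (hh : ContinuousOn h J) (hlap : ∀ x, laplacian g (v ∘ π) x = h (π x))
    {f : ℝ → ℝ} (hf : ∀ s ∈ J, ContDiffAt ℝ 2 f (v s))
    (hu : ContMDiff 𝓘(ℝ, E) 𝓘(ℝ, ℝ) 2 (f ∘ v ∘ π))
    (h0 : ∃ x, ε + gradNormSq g (f ∘ v ∘ π) x ≠ 0) :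
    IsTranslatingSoliton 𝓘(ℝ, E) g ε (graphMap (f ∘ v ∘ π)) ↔
      ∀ s ∈ J, deriv (deriv f) (v s) =
        (e + ε * deriv f (v s) ^ 2) * (1 - deriv f (v s) * h s) := by
  have hmem : ∀ x, π x ∈ J := fun x ↦ hπJ ▸ Set.mem_range_self x
  have hw1 := hw.mdifferentiable (by norm_num)
  have hf1 : ∀ s ∈ J, HasDerivAt f (deriv f (v s)) (v s) := fun s hs ↦
    ((hf s hs).differentiableAt (by norm_num)).hasDerivAt
  have hf2 : ∀ s ∈ J, ContDiffAt ℝ 1 (deriv f) (v s) := fun s hs ↦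
    ((hf s hs).fderiv_right (m := 1) (by norm_num)).clm_apply contDiffAt_const
  have hQ : ∀ x, ε + gradNormSq g (f ∘ v ∘ π) x =
      ε * e * (e + ε * deriv f (v (π x)) ^ 2) := fun x ↦ by
    rw [gradNormSq_comp (hw1 x) (hf1 _ (hmem x)), hwe]
    linear_combination (-ε) * he - e * deriv f (v (π x)) ^ 2 * hε
  have heq := fun (x : M) (hx : ε + gradNormSq g (f ∘ v ∘ π) x ≠ 0) ↦
    hlap x ▸ soliton_equation_comp_iff hg hε he hw hwe (hf _ (hmem x)) hx
  rw [isTranslatingSoliton_graphMap_iff hg hε hu]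
  constructor
  · rintro ⟨h1, h2⟩ s hs
    obtain ⟨x, rfl⟩ := hπJ ▸ hs
    exact (heq x (h1 x)).1 (h2 x)
  · intro hode
    have hne : ∀ x, ε + gradNormSq g (f ∘ v ∘ π) x ≠ 0 := by
      obtain ⟨x₁, hx₁⟩ := h0
      rw [hQ] at hx₁
      have hvc : ContinuousOn v J := fun s hs ↦ (hv s hs).continuousAt.continuousWithinAt
      have hfc : ContinuousOn (fun s ↦ deriv f (v s)) J := fun s hs ↦
        ((hf2 s hs).continuousAt.comp (hv s hs).continuousAt).continuousWithinAt
      have hnz := ne_zero_of_linear_ode hJ hJc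
        (k := fun s ↦ 2 * ε * deriv f (v s) * (1 - deriv f (v s) * h s) * r s)
        (Q := fun s ↦ e + ε * deriv f (v s) ^ 2)
        (((continuousOn_const.mul hfc).mul (continuousOn_const.sub (hfc.mul hh))).mul hr)
        (fun s hs ↦ by
          have hd := (((hf2 s hs).differentiableAt (by norm_num)).hasDerivAt.comp s (hv s hs))
          refine (((hd.pow 2).const_mul ε).const_add e).congr_deriv ?_
          rw [hode s hs]
          simp only [Function.comp_apply]
          push_cast
          ring)
        (hmem x₁) (right_ne_zero_of_mul hx₁)
      intro x
      rw [hQ]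
      exact mul_ne_zero (left_ne_zero_of_mul hx₁) (hnz _ (hmem x))
    exact ⟨hne, fun x ↦ (heq x (hne x)).2 (hode _ (hmem x))⟩

end InvariantSolitons

end SemiRiem

end

open SemiRiem in
theorem mainTheorem7
    -- a connected semi-Riemannian manifold `(M, g)`
    {E : Type*} [NormedAddCommGroup E] [NormedSpace ℝ E] [FiniteDimensional ℝ E]
    {M : Type*} [TopologicalSpace M] [ChartedSpace E M] [IsManifold 𝓘(ℝ, E) ∞ M]
    [T2Space M] [SecondCountableTopology M] [ConnectedSpace M]
    (g : SemiRiem.TensorField2 𝓘(ℝ, E) M) (hg : SemiRiem.IsSemiRiemannianMetric g)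
    -- a Lie group acting smoothly on `M` by isometries
    {ES : Type*} [NormedAddCommGroup ES] [NormedSpace ℝ ES] [FiniteDimensional ℝ ES]
    {HS : Type*} [TopologicalSpace HS] (IS : ModelWithCorners ℝ ES HS)
    {S : Type*} [TopologicalSpace S] [ChartedSpace HS S] [Group S] [LieGroup IS ∞ S]
    [MulAction S M] [ContMDiffSMul IS 𝓘(ℝ, E) ∞ S M]
    (hS : SemiRiem.ActsByIsometries S g)
    -- a submersion onto an open interval whose fibers are the orbits
    (I : Set ℝ) (hIopen : IsOpen I) (hIconn : I.OrdConnected)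
    (π : M → ℝ) (hπrange : Set.range π = I) (hπ : ContMDiff 𝓘(ℝ, E) 𝓘(ℝ, ℝ) ∞ π)
    (hπsub : ∀ x, Function.Surjective (mfderiv 𝓘(ℝ, E) 𝓘(ℝ, ℝ) π x))
    (hfib : ∀ x : M, π ⁻¹' {π x} = MulAction.orbit S x)
    -- `h` represents the mean curvature of the fibers
    (h : ℝ → ℝ) (hh : ∀ x, SemiRiem.levelMeanCurvature g π x = h (π x))
    (hlight : ∀ x, ¬ SemiRiem.IsLightlike g x (SemiRiem.gradient g π x))
    -- the sign of the metric on the factor `ℝ` of `M × ℝ`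
    (ε : ℝ) (hε : ε = 1 ∨ ε = -1) :
    -- `εt` is the sign of `|∇π|²`, the sign of the metric `εt ds²` on the interval
    ∃ εt : ℝ, (εt = 1 ∨ εt = -1) ∧ (∀ x, 0 < εt * SemiRiem.gradNormSq g π x) ∧
      (∃ v : ℝ → ℝ, ∀ x, HasDerivAt v (√(εt * SemiRiem.gradNormSq g π x))⁻¹ (π x)) ∧
      ∀ v : ℝ → ℝ, (∀ x, HasDerivAt v (√(εt * SemiRiem.gradNormSq g π x))⁻¹ (π x)) →
        ∀ u : M → ℝ, ContMDiff 𝓘(ℝ, E) 𝓘(ℝ, ℝ) 2 u →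
          (∃ x, ε + SemiRiem.gradNormSq g u x ≠ 0) →
          ((SemiRiem.IsTranslatingSoliton 𝓘(ℝ, E) g ε (SemiRiem.graphMap u) ∧
              SemiRiem.IsInvariantUnder S u) ↔
            ∃ f : ℝ → ℝ, ContDiffOn ℝ 2 f (v '' I) ∧
              (∀ s ∈ I, deriv (deriv f) (v s) =
                (εt + ε * deriv f (v s) ^ 2) * (1 - deriv f (v s) * h s)) ∧
              ∀ x, u x = f (v (π x))) := by
  have hd0 : ∀ x, differential (E := E) π x ≠ 0 := fun x hx ↦ by
    obtain ⟨a, ha⟩ := hπsub x 1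
    exact zero_ne_one ((DFunLike.congr_fun hx a).symm.trans ha)
  have hπ2 : ContMDiff 𝓘(ℝ, E) 𝓘(ℝ, ℝ) 2 π := hπ.of_le two_le_infty
  have hπ1 : MDifferentiable 𝓘(ℝ, E) 𝓘(ℝ, ℝ) π := hπ.mdifferentiable (by simp)
  have hπinv : ∀ (σ : S) (x : M), π (σ • x) = π x := fun σ x ↦ by
    have : σ • x ∈ π ⁻¹' {π x} := hfib x ▸ MulAction.mem_orbit x σ
    exact this
  have horbit : ∀ x y, π x = π y → ∃ σ : S, σ • x = y := fun x y hxy ↦ by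
    have : y ∈ MulAction.orbit S x := hfib x ▸ hxy.symm
    exact this
  have hmem : ∀ x, π x ∈ I := fun x ↦ hπrange ▸ Set.mem_range_self x
  have hGinv : ∀ (σ : S) (x : M), gradNormSq g π (σ • x) = gradNormSq g π x := fun σ x ↦
    gradNormSq_smul_isometry hg hS hπ1
      ((ContMDiffSMul.contMDiff_const_smul (I := IS) (n := ∞) σ).mdifferentiable (by simp))
      (hπinv σ) x
  have hε1 : ε * ε = 1 := mul_self_eq_one_iff.2 hε
  obtain ⟨εt, hεt, hG⟩ := exists_sign_mul_pos (contMDiff_gradNormSq hg hπ2).continuous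
    fun x ↦ gradNormSq_ne_zero hg (hd0 x) (hlight x)
  have hεt1 : εt * εt = 1 := mul_self_eq_one_iff.2 hεt
  obtain ⟨r, hr⟩ : ∃ r : ℝ → ℝ, ∀ x, r (π x) = (√(εt * gradNormSq g π x))⁻¹ := by
    refine ⟨Function.extend π (fun x ↦ (√(εt * gradNormSq g π x))⁻¹) 0, fun x ↦ ?_⟩
    refine Function.FactorsThrough.extend_apply (fun x y hxy ↦ ?_) _ x
    obtain ⟨σ, rfl⟩ := horbit x y hxy
    simp only [hGinv]
  have hrI : ContDiffOn ℝ 1 r I := fun s hs ↦ by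
    obtain ⟨x, rfl⟩ := hπrange ▸ hs
    exact (contDiffAt_speed hg hπ2 (hd0 x) hG hr).contDiffWithinAt
  have hrpos : ∀ s ∈ I, 0 < r s := fun s hs ↦ by
    obtain ⟨x, rfl⟩ := hπrange ▸ hs
    exact hr x ▸ inv_pos.2 (Real.sqrt_pos.2 (hG x))
  refine ⟨εt, hεt, hG, ?_, fun v hv u hu hu0 ↦ ?_⟩
  · obtain ⟨v, hv⟩ := exists_antiderivative hIopen hIconn hrI.continuousOn
    exact ⟨v, fun x ↦ hr x ▸ hv _ (hmem x)⟩
  have hvI : ∀ s ∈ I, HasDerivAt v (r s) s := fun s hs ↦ by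
    obtain ⟨x, rfl⟩ := hπrange ▸ hs
    exact hr x ▸ hv x
  have hv2 := contDiffOn_two_of_hasDerivAt hIopen hrI hvI
  have hvinj := injOn_of_hasDerivAt_pos hIconn hrpos hvI
  have hvnhds : ∀ s ∈ I, v '' I ∈ nhds (v s) := fun s hs ↦
    image_mem_nhds_of_hasDerivAt hIopen hv2 hs ((hvI s hs).deriv ▸ (hrpos s hs).ne')
  have hw : ContMDiff 𝓘(ℝ, E) 𝓘(ℝ, ℝ) 2 (v ∘ π) := fun x ↦
    ContMDiffAt.comp x (hv2.contDiffAt (hIopen.mem_nhds (hmem x))).contMDiffAt (hπ2 x)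
  have hdw : ∀ x, differential (E := E) (v ∘ π) x = r (π x) • differential (E := E) π x :=
    fun x ↦ differential_comp (hπ1 x) (hvI _ (hmem x))
  have hdw0 : ∀ x, differential (E := E) (v ∘ π) x ≠ 0 := fun x ↦ by
    rw [hdw]
    exact smul_ne_zero (hrpos _ (hmem x)).ne' (hd0 x)
  have hwe := gradNormSq_comp_eq_sign hπ1 hεt1 hG hv
  have hlap : ∀ x, laplacian g (v ∘ π) x = h (π x) := fun x ↦ by
    rw [← hh, levelMeanCurvature_eq_laplacian hg hw
      (unitNormal_eq_gradient_comp hπ1 hεt1 hG hv) (fun a ↦ ?_) hεt1 hwe]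
    rw [hdw, LinearMap.smul_apply, smul_eq_mul, mul_eq_zero,
      or_iff_right (hrpos _ (hmem x)).ne']
  have hhI : ContinuousOn h I := fun s hs ↦ by
    obtain ⟨x, rfl⟩ := hπrange ▸ hs
    have hc : Continuous (h ∘ π) := (continuous_laplacian hg hw).congr hlap
    refine (contDiffAt_of_comp (m := 0) (n := 2) (by norm_num) two_le_infty (by norm_num)
      (hπ2 x) (hd0 x) ?_).continuousAt.continuousWithinAt
    exact contMDiff_zero_iff.2 hc x
  have key := fun (f : ℝ → ℝ) (hf : ∀ s ∈ I, ContDiffAt ℝ 2 f (v s)) (hfu : u = f ∘ v ∘ π) ↦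
    isTranslatingSoliton_comp_iff (f := f) hg hε1 hεt1 hIopen hIconn hπrange hvI hrI.continuousOn
      hw hwe hhI hlap hf (hfu ▸ hu) (hfu ▸ hu0)
  constructor
  · rintro ⟨hsol, hinv⟩
    have hfac : Function.FactorsThrough u (v ∘ π) := fun x y hxy ↦ by
      obtain ⟨σ, rfl⟩ := horbit x y (hvinj (hmem x) (hmem y) hxy)
      exact (hinv σ x).symm
    have hfu : u = Function.extend (v ∘ π) u 0 ∘ v ∘ π :=
      funext fun x ↦ (hfac.extend_apply 0 x).symm
    have hf : ∀ s ∈ I, ContDiffAt ℝ 2 (Function.extend (v ∘ π) u 0) (v s) := fun s hs ↦ by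
      obtain ⟨x, rfl⟩ := hπrange ▸ hs
      exact contDiffAt_of_comp (w := v ∘ π) (n := 2) (by norm_num) two_le_infty le_rfl (hw x)
        (hdw0 x) (hfu ▸ hu x)
    refine ⟨_, ?_, (key _ hf hfu).1 (hfu ▸ hsol), congrFun hfu⟩
    rintro _ ⟨s, hs, rfl⟩
    exact (hf s hs).contDiffWithinAt
  · rintro ⟨f, hf, hode, hfu⟩
    have hfu' : u = f ∘ v ∘ π := funext hfu
    refine ⟨?_, fun σ x ↦ by rw [hfu, hfu, hπinv]⟩
    rw [hfu']
    exact (key f (fun s hs ↦ (hf _ ⟨s, hs, rfl⟩).contDiffAt (hvnhds s hs)) hfu').2 hode
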